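/- Let $k$ be an algebraically closed field, $Q$ a finite connected quiver, $Z$ a set of paths of $Q$ of length $\ge 2$ such that no proper subpath of a path in $Z$ is again in $Z$, and suppose that the monomial algebra $\Lambda=kQ/\langle Z\rangle$ is finite dimensional. Let $\mathrm H^1(\Lambda,\Lambda)$ be the Lie algebra of $k$-linear derivations of $\Lambda$ modulo inner derivations. Notation. $Q_0$ and $Q_1$ are the sets of vertices and of arrows of $Q$. $B$ is the set of paths of $Q$ that contain no element of $Z$ as a subpath. Two paths are parallel if they have the same source and the same terminus; $X//Y$ is the set of pairs of parallel paths $(\varepsilon,\gamma)\in X\times Y$, $k(X//Y)$ is the vector space with basis $X//Y$, and $Q_1//$ is the set of equivalence classes of parallel arrows. For a path $p$ and $(a,\gamma)\in Q_1//B$, let $p^{(a,\gamma)}$ be the sum, over all appearances of the arrow $a$ in $p$, of the path obtained by replacing this appearance of $a$ by $\gamma$, where replacements that do not lie in $B$ are omitted. Let $\psi_1:k(Q_1//B)\to k(Z//B)$, $\psi_1(a,\gamma)=\sum_{p\in Z}(p,p^{(a,\gamma)})$, and let $L_{-1}=k(Q_1//Q_0)\cap\operatorname{Ker}\psi_1$.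 The ideal $\langle Z\rangle$ is completely saturated if $p^{(b,a)}=0$ for all $p\in Z$ and all $(a,b)\in Q_1//Q_1$. Let $\bar Q$ be the subquiver of $Q$ with all the vertices of $Q$ and one representative of every class of parallel arrows. A quiver is a tree if it is connected and has no oriented or non-oriented cycle (in particular no loop and no pair of distinct arrows joining the same two vertices, in whatever directions). Put $\mathfrak{pgl}(n,k)=\mathfrak{gl}(n,k)/k1$. A Lie algebra is called semisimple if it is nonzero and its radical (its largest solvable ideal) is zero. Theorem. Suppose that $L_{-1}=0$. The following conditions are equivalent: 1. The Lie algebra $\mathrm H^1(\Lambda,\Lambda)$ is semisimple. 2. The quiver $\bar Q$ is a tree, $Q$ has at least one class of parallel arrows with at least two elements, and the ideal $\langle Z\rangle$ is completely saturated. If the characteristic of $k$ is $2$, then moreover $Q$ does not have a class of parallel arrows containing exactly two arrows. 3. The product of Lie algebras $\prod_{\bar\alpha\in Q_1//}\mathfrak{pgl}(|\bar\alpha|,k)$ is nonzero, $\mathrm H^1(\Lambda,\Lambda)$ is isomorphic to it as a Lie algebra over $k$, and $|\bar\alpha|\ne 2$ for all $\bar\alpha\in Q_1//$ if the characteristic of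 $k$ is $2$. -/

import Mathlib

open Quiver (Path)

universe u v w

noncomputable section

/-! ### The path algebra of a quiver -/

section PathAlgebra

/-- The set of all oriented paths of a quiver (including the trivial ones, i.e. the vertices). -/
abbrev QuiverPath (V : Type u) [Quiver.{v} V] : Type (max u v) :=
  Σ (a b : V), Path a b

/-- The path algebra `kQ`: the `k`-linear span of the set of paths. -/
def PathAlgebra (k : Type w) [Field k] (V : Type u) [Quiver.{v} V] : Type (max u v w) :=
  QuiverPath V →₀ k

namespace PathAlgebra

variable (k : Type w) [Field k] (V : Type u) [Quiver.{v} V]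

instance : AddCommGroup (PathAlgebra k V) :=
  inferInstanceAs (AddCommGroup (QuiverPath V →₀ k))

instance : Module k (PathAlgebra k V) :=
  inferInstanceAs (Module k (QuiverPath V →₀ k))

variable {V}

/-- A path, as an element of the path algebra. -/
def of {a b : V} (p : Path a b) : PathAlgebra k V :=
  (Finsupp.single (⟨a, b, p⟩ : QuiverPath V) (1 : k) : QuiverPath V →₀ k)

open scoped Classical in
/-- The product `βα` of two paths: the concatenation (first `α`, then `β`) if the terminus of
`α` is the source of `β`, and `0` otherwise. -/
def pathMul (β α : QuiverPath V) : PathAlgebra k V :=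
  if h : α.2.1 = β.1 then of k ((α.2.2.cast rfl h).comp β.2.2) else 0

/-- The bilinear extension of the concatenation of paths. -/
def mulBilin : PathAlgebra k V →ₗ[k] PathAlgebra k V →ₗ[k] PathAlgebra k V :=
  Finsupp.linearCombination k fun β : QuiverPath V =>
    (Finsupp.linearCombination k fun α : QuiverPath V => pathMul k β α :
      (QuiverPath V →₀ k) →ₗ[k] PathAlgebra k V)

instance : Mul (PathAlgebra k V) := ⟨fun x y => mulBilin k x y⟩

/-- The unit of the path algebra is the sum of the vertices. -/
instance [Fintype V] : One (PathAlgebra k V) := ⟨∑ e : V, of k (Path.nil : Path e e)⟩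

variable {k}

theorem mul_def (x y : PathAlgebra k V) : x * y = mulBilin k x y := rfl

theorem one_def [Fintype V] :
    (1 : PathAlgebra k V) = ∑ e : V, of k (Path.nil : Path e e) := rfl

theorem of_mul_of {a b c d : V} (β : Path c d) (α : Path a b) :
    of k β * of k α = pathMul k ⟨c, d, β⟩ ⟨a, b, α⟩ := by
  rw [mul_def]
  have h1 : mulBilin k (of k β) = (Finsupp.linearCombination k fun x : QuiverPath V =>
      pathMul k ⟨c, d, β⟩ x : (QuiverPath V →₀ k) →ₗ[k] PathAlgebra k V) :=
    (Finsupp.linearCombination_single k (1 : k) _).trans (one_smul _ _)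
  rw [h1]
  exact (Finsupp.linearCombination_single k (1 : k) _).trans (one_smul _ _)

theorem of_mul_of_comp {a b c : V} (β : Path b c) (α : Path a b) :
    of k β * of k α = of k (α.comp β) := by
  rw [of_mul_of, pathMul, dif_pos rfl]
  rfl

theorem of_mul_of_ne {a b c d : V} (β : Path c d) (α : Path a b) (h : b ≠ c) :
    of k β * of k α = 0 := by
  rw [of_mul_of, pathMul, dif_neg h]

theorem induction_on {P : PathAlgebra k V → Prop} (x : PathAlgebra k V) (h0 : P 0)
    (hadd : ∀ x y, P x → P y → P (x + y))
    (hof : ∀ (c : k) {a b : V} (p : Path a b), P (c • of k p)) : P x := by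
  refine Finsupp.induction_linear (motive := P) x h0 hadd ?_
  rintro ⟨a, b, p⟩ c
  have h : (Finsupp.single (⟨a, b, p⟩ : QuiverPath V) c : QuiverPath V →₀ k) = c • of k p :=
    (((Finsupp.smul_single _ _ _).trans (by rw [smul_eq_mul, mul_one])) :
      c • (Finsupp.single (⟨a, b, p⟩ : QuiverPath V) (1 : k) : QuiverPath V →₀ k) = _).symm
  exact h ▸ hof c p

theorem smul_mul (c : k) (x y : PathAlgebra k V) : c • x * y = c • (x * y) := by
  simp only [mul_def, map_smul, LinearMap.smul_apply]

theorem mul_smul' (c : k) (x y : PathAlgebra k V) : x * c • y = c • (x * y) := by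
  simp only [mul_def, map_smul]

theorem add_mul' (x y z : PathAlgebra k V) : (x + y) * z = x * z + y * z := by
  simp only [mul_def, map_add, LinearMap.add_apply]

theorem mul_add' (x y z : PathAlgebra k V) : x * (y + z) = x * y + x * z := by
  simp only [mul_def, map_add]

theorem zero_mul' (x : PathAlgebra k V) : 0 * x = 0 := by
  simp only [mul_def, map_zero, LinearMap.zero_apply]

theorem mul_zero' (x : PathAlgebra k V) : x * 0 = 0 := by
  simp only [mul_def, map_zero]

theorem of_mul_assoc {a b c d e f : V} (p : Path a b) (q : Path c d) (r : Path e f) :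
    of k p * of k q * of k r = of k p * (of k q * of k r) := by
  by_cases h : d = a
  · subst h
    rw [of_mul_of_comp]
    by_cases h' : f = c
    · subst h'
      rw [of_mul_of_comp, of_mul_of_comp, of_mul_of_comp, Path.comp_assoc]
    · rw [of_mul_of_ne _ _ h', of_mul_of_ne _ _ h', mul_zero']
  · rw [of_mul_of_ne _ _ h, zero_mul']
    by_cases h' : f = c
    · subst h'
      rw [of_mul_of_comp, of_mul_of_ne _ _ h]
    · rw [of_mul_of_ne _ _ h', mul_zero']

theorem mul_assoc' (x y z : PathAlgebra k V) : x * y * z = x * (y * z) := by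
  induction x using induction_on with
  | h0 => simp only [zero_mul']
  | hadd x₁ x₂ h₁ h₂ => simp only [add_mul', h₁, h₂]
  | hof c p =>
    induction y using induction_on with
    | h0 => simp only [zero_mul', mul_zero']
    | hadd y₁ y₂ h₁ h₂ => simp only [add_mul', mul_add', h₁, h₂]
    | hof c' q =>
      induction z using induction_on with
      | h0 => simp only [mul_zero']
      | hadd z₁ z₂ h₁ h₂ => simp only [mul_add', h₁, h₂]
      | hof c'' r => simp only [smul_mul, mul_smul', of_mul_assoc]

theorem sum_mul' {ι : Type*} (s : Finset ι) (f : ι → PathAlgebra k V) (y : PathAlgebra k V) :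
    (∑ i ∈ s, f i) * y = ∑ i ∈ s, f i * y := by
  simp only [mul_def, map_sum, LinearMap.sum_apply]

theorem mul_sum' {ι : Type*} (s : Finset ι) (f : ι → PathAlgebra k V) (y : PathAlgebra k V) :
    y * (∑ i ∈ s, f i) = ∑ i ∈ s, y * f i := by
  simp only [mul_def, map_sum]

theorem one_mul' [Fintype V] (x : PathAlgebra k V) : 1 * x = x := by
  induction x using induction_on with
  | h0 => exact mul_zero' _
  | hadd x y hx hy => rw [mul_add', hx, hy]
  | @hof c a b p =>
    rw [mul_smul', one_def, sum_mul', Finset.sum_eq_single b, of_mul_of_comp, Path.comp_nil]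
    · intro e _ he
      exact of_mul_of_ne _ _ he.symm
    · intro h
      exact absurd (Finset.mem_univ b) h

theorem mul_one' [Fintype V] (x : PathAlgebra k V) : x * 1 = x := by
  induction x using induction_on with
  | h0 => exact zero_mul' _
  | hadd x y hx hy => rw [add_mul', hx, hy]
  | @hof c a b p =>
    rw [smul_mul, one_def, mul_sum', Finset.sum_eq_single a, of_mul_of_comp, Path.nil_comp]
    · intro e _ he
      exact of_mul_of_ne _ _ he
    · intro h
      exact absurd (Finset.mem_univ a) h

instance [Fintype V] : Ring (PathAlgebra k V) :=
  { (inferInstance : AddCommGroup (PathAlgebra k V)),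
    (inferInstance : Mul (PathAlgebra k V)),
    (inferInstance : One (PathAlgebra k V)) with
    left_distrib := mul_add'
    right_distrib := add_mul'
    zero_mul := zero_mul'
    mul_zero := mul_zero'
    mul_assoc := mul_assoc'
    one_mul := one_mul'
    mul_one := mul_one' }

instance [Fintype V] : Algebra k (PathAlgebra k V) :=
  Algebra.ofModule smul_mul mul_smul'

end PathAlgebra

end PathAlgebra

/-! ### Monomial algebras -/

section Monomial

variable {V : Type u} [Quiver.{v} V]

/-- A set of paths of a quiver. -/
abbrev PathSet (V : Type u) [Quiver.{v} V] : Type (max u v) :=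
  ∀ a b : V, Set (Path a b)

/-- `Z` consists of paths of length at least two, and it is minimal: whenever an element `q` of
`Z` is a subpath of an element `(l q r)` of `Z`, it is not a proper subpath. -/
structure IsMinimalRelations (Z : PathSet V) : Prop where
  two_le_length : ∀ ⦃a b : V⦄ (p : Path a b), p ∈ Z a b → 2 ≤ p.length
  minimal : ∀ ⦃a b c d : V⦄ (l : Path a b) (q : Path b c) (r : Path c d),
    q ∈ Z b c → (l.comp q).comp r ∈ Z a d → l.length = 0 ∧ r.length = 0

/-- The set `B` of the paths which do not contain an element of `Z` as a subpath. -/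
def nonzeroPaths (Z : PathSet V) : PathSet V := fun a b =>
  {p | ∀ (c d : V) (l : Path a c) (q : Path c d) (r : Path d b),
    q ∈ Z c d → (l.comp q).comp r ≠ p}

variable (k : Type w) [Field k]

/-- The two-sided ideal `⟨Z⟩` of the path algebra generated by a set `Z` of paths. -/
def relationIdeal [Fintype V] (Z : PathSet V) : TwoSidedIdeal (PathAlgebra k V) :=
  TwoSidedIdeal.span {x | ∃ (a b : V) (p : Path a b), p ∈ Z a b ∧ x = PathAlgebra.of k p}

/-- The monomial algebra `Λ = kQ/⟨Z⟩`. -/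
abbrev MonomialAlgebra [Fintype V] (Z : PathSet V) : Type (max u v w) :=
  PathAlgebra k V ⧸ (relationIdeal k Z).asIdeal

/-- The appearances of the arrow `e` in the path `p`: the factorizations of `p` into a path `q`
followed by `e` followed by a path `r`. -/
abbrev Appearance {a b c d : V} (e : b ⟶ c) (p : Path a d) : Type (max u v) :=
  {qr : Path a b × Path c d // (qr.1.cons e).comp qr.2 = p}

instance {a b c d : V} (e : b ⟶ c) (p : Path a d) : Finite (Appearance e p) := by
  refine Finite.of_injective
    (fun x : Appearance e p => (⟨x.1.1.length, ?_⟩ : Fin p.length)) ?_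
  · have h := congrArg Path.length x.2
    simp only [Path.length_comp, Path.length_cons] at h
    omega
  · rintro ⟨⟨q, r⟩, h⟩ ⟨⟨q', r'⟩, h'⟩ hl
    have hl' : q.length = q'.length := congrArg Fin.val hl
    have h2 := (Path.comp_inj' (by simpa using hl')).1 (h.trans h'.symm)
    have h3 : q = q' := by simpa using h2.1
    obtain rfl := h3
    obtain rfl := h2.2
    rfl

open scoped Classical in
/-- `p^(e,γ)`: the sum of all paths in `B` obtained by replacing one appearance of the arrow `e`
in the path `p` by the path `γ` parallel to `e`; the appearances which do not yield a path in `B`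
contribute `0`. -/
def replaceSum (Z : PathSet V) {a b c d : V} (p : Path a d) (e : b ⟶ c) (γ : Path b c) :
    Path a d →₀ k :=
  ∑ᶠ x : Appearance e p,
    if (x.1.1.comp γ).comp x.1.2 ∈ nonzeroPaths Z a d
    then Finsupp.single ((x.1.1.comp γ).comp x.1.2) 1 else 0

/-- `Q₁//B`: the pairs `(e, γ)` of an arrow `e` and a path `γ ∈ B` parallel to `e`. -/
structure ArrowPathPair (Z : PathSet V) : Type (max u v) where
  {src : V}
  {tgt : V}
  arrow : src ⟶ tgt
  path : Path src tgt
  path_mem : path ∈ nonzeroPaths Z src tgt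

/-- `Z//B`: the pairs `(p, η)` of a path `p ∈ Z` and a path `η ∈ B` parallel to `p`. -/
structure RelationPathPair (Z : PathSet V) : Type (max u v) where
  {src : V}
  {tgt : V}
  rel : Path src tgt
  rel_mem : rel ∈ Z src tgt
  path : Path src tgt
  path_mem : path ∈ nonzeroPaths Z src tgt

/-- The map `ψ₁ : k(Q₁//B) → k(Z//B)`, `(e, γ) ↦ ∑_{p ∈ Z} (p, p^(e,γ))`. An element of `k(Z//B)`
is given by its family of coefficients (the set `Z//B` is finite as soon as `kQ/⟨Z⟩` is finite
dimensional). -/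
def psiOne (Z : PathSet V) : (ArrowPathPair Z →₀ k) →ₗ[k] (RelationPathPair Z → k) :=
  Finsupp.linearCombination k fun x : ArrowPathPair Z =>
    fun y : RelationPathPair Z => replaceSum k Z y.rel x.arrow x.path y.path

/-- `L₋₁ = k(Q₁//Q₀) ∩ Ker ψ₁`, where `k(Q₁//Q₀)` is spanned by the pairs `(e, γ)` such that `γ`
has length `0`. -/
def LMinusOne (Z : PathSet V) : Submodule k (ArrowPathPair Z →₀ k) :=
  Finsupp.supported k k {x : ArrowPathPair Z | x.path.length = 0} ⊓ LinearMap.ker (psiOne k Z)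

/-- The ideal `⟨Z⟩` is `(e, f)`-saturated: `p^(f,e) = 0` for all `p ∈ Z`. -/
def IsSaturated (Z : PathSet V) {b c : V} (e f : b ⟶ c) : Prop :=
  ∀ (a d : V) (p : Path a d), p ∈ Z a d → replaceSum k Z p f e.toPath = 0

/-- The ideal `⟨Z⟩` is completely saturated: it is `(e, f)`-saturated for every couple of parallel
arrows. -/
def IsCompletelySaturated (Z : PathSet V) : Prop :=
  ∀ (b c : V) (e f : b ⟶ c), IsSaturated k Z e f

end Monomial

/-! ### Parallel arrows, connected quivers and trees -/

section Parallel

variable (V : Type u) [Quiver.{v} V]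

/-- Parallelism of arrows: same source and same terminus. -/
def parallelSetoid : Setoid (Quiver.Total V) where
  r x y := x.left = y.left ∧ x.right = y.right
  iseqv := ⟨fun _ => ⟨rfl, rfl⟩, fun h => ⟨h.1.symm, h.2.symm⟩,
    fun h h' => ⟨h.1.trans h'.1, h.2.trans h'.2⟩⟩

/-- The set `Q₁//` of classes of parallel arrows. -/
abbrev ParallelClass : Type (max u v) := Quotient (parallelSetoid V)

variable {V} in
/-- The number of arrows in a class of parallel arrows. -/
def ParallelClass.card (c : ParallelClass V) : ℕ :=
  Nat.card {x : Quiver.Total V // Quotient.mk (parallelSetoid V) x = c}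

/-- The subquiver `Q̄` of `Q` obtained by taking a representative for every class of parallel
arrows. -/
def representativeSubquiver : WideSubquiver V := fun a b =>
  {e | Quotient.out (Quotient.mk (parallelSetoid V) ⟨a, b, e⟩) = ⟨a, b, e⟩}

/-- The simple graph underlying a quiver: orientation, multiplicities and loops are forgotten. -/
def underlyingGraph : SimpleGraph V := SimpleGraph.fromRel fun a b : V => Nonempty (a ⟶ b)

/-- A quiver is connected if it is nonempty and any two vertices are joined by a non-oriented
path. -/
def QuiverConnected : Prop := (underlyingGraph V).Connected

/-- A quiver is a tree if it is connected and has no (oriented or non-oriented) cycle: there are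
no cycles of length one (loops), no cycles of length two (pairs of distinct arrows joining the same
two vertices, in whatever direction), and the underlying simple graph is a tree. -/
structure QuiverIsTree : Prop where
  no_loop : ∀ a : V, IsEmpty (a ⟶ a)
  no_two_cycle : ∀ a b : V, Subsingleton ((a ⟶ b) ⊕ (b ⟶ a))
  isTree : (underlyingGraph V).IsTree

end Parallel

/-! ### Lie algebras -/

section Lie

attribute [local instance] LieRing.ofAssociativeRing LieAlgebra.ofAssociativeAlgebra

variable (k : Type u) [Field k] (A : Type v) [Ring A] [Algebra k A]

/-- The Lie algebra `Der_k(A)` of the `k`-linear derivations of `A`, a Lie subalgebra of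
`Hom_k(A, A)` with the bracket `[f, g] = f ∘ g - g ∘ f`. -/
def hochschildDer : LieSubalgebra k (Module.End k A) where
  carrier := {f | ∀ a b : A, f (a * b) = a * f b + f a * b}
  add_mem' := by
    intro f g hf hg a b
    simp only [LinearMap.add_apply, hf a b, hg a b, mul_add, add_mul]
    abel
  zero_mem' := by
    intro a b
    simp
  smul_mem' := by
    intro c f hf a b
    simp only [LinearMap.smul_apply, hf a b, smul_add, mul_smul_comm, smul_mul_assoc]
  lie_mem' := by
    intro f g hf hg a b
    have hf' : ∀ a b : A, f (a * b) = a * f b + f a * b := hf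
    have hg' : ∀ a b : A, g (a * b) = a * g b + g a * b := hg
    simp only [LieRing.of_associative_ring_bracket, LinearMap.sub_apply, Module.End.mul_apply,
      hf', hg', map_add, mul_sub, sub_mul]
    abel

/-- The Lie ideal of the inner derivations `x ↦ ax - xa`. -/
def innerDer : LieIdeal k (hochschildDer k A) where
  carrier := {f | ∃ a : A, ∀ x : A, (f : Module.End k A) x = a * x - x * a}
  add_mem' := by
    rintro f g ⟨a, ha⟩ ⟨b, hb⟩
    refine ⟨a + b, fun x => ?_⟩
    have h : ((f + g : hochschildDer k A) : Module.End k A) x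
        = (f : Module.End k A) x + (g : Module.End k A) x := rfl
    rw [h, ha, hb, add_mul, mul_add]
    abel
  zero_mem' := ⟨0, fun x => by simp⟩
  smul_mem' := by
    rintro c f ⟨a, ha⟩
    refine ⟨c • a, fun x => ?_⟩
    have h : ((c • f : hochschildDer k A) : Module.End k A) x = c • (f : Module.End k A) x := rfl
    rw [h, ha, smul_sub, smul_mul_assoc, mul_smul_comm]
  lie_mem := by
    rintro f g ⟨a, ha⟩
    refine ⟨(f : Module.End k A) a, fun x => ?_⟩
    have h : ((⁅f, g⁆ : hochschildDer k A) : Module.End k A) x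
        = (f : Module.End k A) ((g : Module.End k A) x)
          - (g : Module.End k A) ((f : Module.End k A) x) := rfl
    have hf : ∀ a b : A, (f : Module.End k A) (a * b)
        = a * (f : Module.End k A) b + (f : Module.End k A) a * b := f.2
    rw [h, ha, ha, map_sub, hf, hf]
    abel

/-- The Lie algebra `H¹(A, A) = Der_k(A) / {inner derivations}`. -/
abbrev HH1 : Type v := hochschildDer k A ⧸ innerDer k A

/-- The Lie ideal `k·1` of `gl(n, k)`. -/
def scalarIdeal (n : ℕ) : LieIdeal k (Matrix (Fin n) (Fin n) k) where
  toSubmodule := Submodule.span k {1}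
  lie_mem := by
    intro x m hm
    obtain ⟨c, rfl⟩ := Submodule.mem_span_singleton.1 hm
    have h : ⁅x, c • (1 : Matrix (Fin n) (Fin n) k)⁆ = 0 := by
      rw [LieRing.of_associative_ring_bracket, mul_smul_comm, smul_mul_assoc, mul_one, one_mul,
        sub_self]
    rw [h]
    exact Submodule.zero_mem _

/-- The Lie algebra `pgl(n, k) = gl(n, k)/k1`. -/
abbrev PGL (n : ℕ) : Type u := Matrix (Fin n) (Fin n) k ⧸ scalarIdeal k n

/-- The product of a family of Lie algebras, with the componentwise bracket. -/
instance piLieRing {ι : Type u} (L : ι → Type v) [∀ i, LieRing (L i)] : LieRing (∀ i, L i) where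
  bracket x y := fun i => ⁅x i, y i⁆
  add_lie x y z := funext fun i => add_lie (x i) (y i) (z i)
  lie_add x y z := funext fun i => lie_add (x i) (y i) (z i)
  lie_self x := funext fun i => lie_self (x i)
  leibniz_lie x y z := funext fun i => leibniz_lie (x i) (y i) (z i)

instance piLieAlgebra {ι : Type u} (k : Type w) [Field k] (L : ι → Type v) [∀ i, LieRing (L i)]
    [∀ i, LieAlgebra k (L i)] : LieAlgebra k (∀ i, L i) where
  lie_smul c x y := funext fun i => lie_smul c (x i) (y i)

/-- A Lie algebra is semisimple if it is nonzero and its (solvable) radical is zero. -/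
def IsSemisimpleLie (L : Type v) [LieRing L] [LieAlgebra k L] : Prop :=
  Nontrivial L ∧ LieAlgebra.radical k L = ⊥

end Lie

end

noncomputable section

/-! ### Lie algebras with trivial radical -/

section TrivialRadical

/-! Filter `Λ` by path length. The condition `L₋₁ = 0` says precisely what is needed for derivations
not to lower length: the vertex coefficients of a derivation on the loops form an element of `L₋₁`.
A derivation therefore acts on the arrows modulo longer paths, which gives the Lie homomorphism
`arrowHom` into matrices indexed by arrows. An entry at `(y, x)` can be nonzero only if `x` and `y`
are parallel and no replacement of an `x` by `y` in a relation gives a nonzero path. Under that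
condition the matrix unit `E_{yx}` itself lifts to a derivation (`matrixUnitLE_of_apply_ne_zero`).
So the image is spanned by matrix units, and these define a preorder on the arrows: `x ≤ y` if
`E_{yx}` lifts.

Suppose the radical of `H¹` is zero; then every ideal of derivations that is abelian modulo inner
ones is inner. Applied to the derivations raising length by `n`, for descending `n`, this shows that
the kernel of `arrowHom` is inner. If the preorder were not symmetric, the derivations supported on
units from non-maximal to maximal arrows would form such an ideal with an off-diagonal member,
whereas inner derivations have diagonal matrices. Once the preorder is an equivalence relation, the
diagonal indicator of a class is central in the image, hence comes from an inner derivation, hence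
is the coboundary of a function on the vertices. A coboundary takes equal values on parallel arrows,
so each class is a full parallel class, which is complete saturation. It is `1` on one class and `0`
on the others, so the corresponding edge is a bridge without loop or reverse arrow: `Q̄` is a tree.

Conversely, on a tree every function on the parallel classes is a coboundary, and only arrows are
parallel to arrows. Modulo inner derivations only the blocks indexed by parallel classes remain,
each up to a scalar, and saturation makes all blocks occur. This is the isomorphism with the product
of the `pgl`. It remains to see that `pgl(n)` has zero radical except for `n = 2` in characteristic
two. -/

theorem radical_eq_bot_iff_forall_abelian {k : Type*} [Field k] {L : Type*} [LieRing L]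
    [LieAlgebra k L] :
    LieAlgebra.radical k L = ⊥ ↔
      ∀ I : LieIdeal k L, (∀ x ∈ I, ∀ y ∈ I, ⁅x, y⁆ = 0) → ∀ x ∈ I, x = 0 := by
  rw [← LieAlgebra.hasTrivialRadical_iff, LieAlgebra.hasTrivialRadical_iff_no_abelian_ideals]
  have habel : ∀ I : LieIdeal k L, IsLieAbelian I ↔ ∀ x ∈ I, ∀ y ∈ I, ⁅x, y⁆ = 0 := by
    refine fun I => ⟨fun h x hx y hy => ?_, fun h => ⟨fun x y => Subtype.ext (h x x.2 y y.2)⟩⟩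
    exact congrArg Subtype.val (h.trivial ⟨x, hx⟩ ⟨y, hy⟩)
  simp only [habel, LieSubmodule.eq_bot_iff]

/-- The image of `I` in `L ⧸ K` is an abelian ideal. With `K` the inner derivations, this allows all
later arguments to be made with derivations instead of cohomology classes. -/
theorem LieIdeal.le_of_lie_mem_of_radical_quotient_eq_bot {k : Type*} [Field k] {L : Type*}
    [LieRing L] [LieAlgebra k L] {K : LieIdeal k L} (hK : LieAlgebra.radical k (L ⧸ K) = ⊥)
    (I : LieIdeal k L) (hI : ∀ x ∈ I, ∀ y ∈ I, ⁅x, y⁆ ∈ K) : I ≤ K := by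
  rw [radical_eq_bot_iff_forall_abelian] at hK
  let J : LieIdeal k (L ⧸ K) :=
    { (I : Submodule k L).map (LieSubmodule.Quotient.mk' K : L →ₗ[k] L ⧸ K) with
      lie_mem := by
        rintro x m ⟨i, hi, rfl⟩
        obtain ⟨x, rfl⟩ := LieSubmodule.Quotient.surjective_mk' K x
        exact ⟨⁅x, i⁆, lie_mem_right k L I x i hi, rfl⟩ }
  intro x hx
  refine (LieSubmodule.Quotient.mk_eq_zero K).1 (hK J ?_ _ ⟨x, hx, rfl⟩)
  rintro _ ⟨a, ha, rfl⟩ _ ⟨b, hb, rfl⟩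
  exact (LieSubmodule.Quotient.mk_eq_zero K).2 (hI a ha b hb)

theorem LieEquiv.radical_eq_bot {k : Type*} [Field k] {L L' : Type*} [LieRing L] [LieAlgebra k L]
    [LieRing L'] [LieAlgebra k L'] (e : L ≃ₗ⁅k⁆ L') (h : LieAlgebra.radical k L' = ⊥) :
    LieAlgebra.radical k L = ⊥ := by
  rw [radical_eq_bot_iff_forall_abelian] at h ⊢
  intro I hI x hx
  have h' := h (I.comap (e.symm : L' →ₗ⁅k⁆ L)) ?_ (e x) ?_
  · exact (map_eq_zero_iff e e.injective).1 h'
  · intro a ha b hb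
    rw [LieIdeal.mem_comap] at ha hb
    have := hI _ ha _ hb
    rw [← LieHom.map_lie] at this
    exact (map_eq_zero_iff e.symm e.symm.injective).1 this
  · rw [LieIdeal.mem_comap]
    exact (congrArg (· ∈ I) (e.symm_apply_apply x)).mpr hx

variable {k : Type w} [Field k] {ι : Type u} {L : ι → Type v} [∀ i, LieRing (L i)]
  [∀ i, LieAlgebra k (L i)]

theorem pi_lie_apply (x y : ∀ i, L i) (i : ι) : ⁅x, y⁆ i = ⁅x i, y i⁆ := rfl

open scoped Classical in
theorem lie_pi_single (x : ∀ i, L i) (i : ι) (y : L i) :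
    ⁅x, Pi.single i y⁆ = Pi.single i ⁅x i, y⁆ := by
  funext j
  rw [pi_lie_apply]
  obtain rfl | h := eq_or_ne j i
  · simp
  · simp [h]

/-- For an abelian ideal `I`, the elements of one factor lying in `I` form an abelian ideal of that
factor, hence vanish. Bracketing `x ∈ I` with the `i`-th factor stays in `I` and in that factor, so
`x i` is central. No finiteness of the index set is needed. -/
theorem pi_radical_eq_bot (h : ∀ i, LieAlgebra.radical k (L i) = ⊥) :
    LieAlgebra.radical k (∀ i, L i) = ⊥ := by
  classical
  simp only [radical_eq_bot_iff_forall_abelian] at h ⊢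
  intro I hI x hx
  funext i
  let J : LieIdeal k (L i) :=
    { carrier := {z | Pi.single i z ∈ I}
      add_mem' := fun {a b} ha hb =>
        (congrArg (· ∈ I) (Pi.single_add i a b)).mpr (add_mem ha hb)
      zero_mem' := by simp
      smul_mem' := fun c a ha =>
        (congrArg (· ∈ I) (Pi.single_smul i c a)).mpr (I.smul_mem c ha)
      lie_mem := fun {y a} ha => by
        have := lie_mem_right k _ I (Pi.single i y) _ ha
        rw [lie_pi_single, Pi.single_eq_same] at this
        exact this }
  have hJ := h i J (fun a ha b hb => by
    have := congrFun (hI _ ha _ hb) i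
    rwa [lie_pi_single, Pi.single_eq_same, Pi.single_eq_same] at this)
  have hcentral : ∀ y : L i, ⁅x i, y⁆ = 0 := fun y => hJ _ <| by
    change Pi.single i _ ∈ I
    rw [← lie_pi_single, ← lie_skew]
    exact neg_mem (lie_mem_right k _ I _ _ hx)
  -- The center is itself an abelian ideal, so it is zero.
  refine h i (LieAlgebra.center k (L i)) (fun a _ b hb => ?_) (x i) ?_
  · exact (LieModule.mem_maxTrivSubmodule k (L i) (L i) b).1 hb a
  · rw [LieModule.mem_maxTrivSubmodule]
    intro y
    rw [← lie_skew, hcentral, neg_zero]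

theorem radical_eq_bot_of_pi (h : LieAlgebra.radical k (∀ i, L i) = ⊥) (i : ι) :
    LieAlgebra.radical k (L i) = ⊥ := by
  classical
  rw [radical_eq_bot_iff_forall_abelian] at h ⊢
  intro I hI x hx
  let J : LieIdeal k (∀ i, L i) :=
    { (I : Submodule k (L i)).map (LinearMap.single k L i) with
      lie_mem := by
        rintro y _ ⟨a, ha, rfl⟩
        exact ⟨⁅y i, a⁆, lie_mem_right k _ I _ _ ha, (lie_pi_single y i a).symm⟩ }
  have := h J ?_ (Pi.single i x) ⟨x, hx, rfl⟩
  · simpa using congrFun this i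
  · rintro _ ⟨a, ha, rfl⟩ _ ⟨b, hb, rfl⟩
    refine (lie_pi_single _ i b).trans ?_
    rw [LinearMap.single_apply, Pi.single_eq_same, hI a ha b hb, Pi.single_zero]

end TrivialRadical

/-! ### The Lie algebras `pgl(n, k)` -/

section ProjectiveLinear

attribute [local instance] LieRing.ofAssociativeRing LieAlgebra.ofAssociativeAlgebra

variable {k : Type u} [Field k] {n : ℕ}

theorem mem_scalarIdeal {x : Matrix (Fin n) (Fin n) k} :
    x ∈ scalarIdeal k n ↔ ∃ c : k, c • (1 : Matrix (Fin n) (Fin n) k) = x :=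
  Submodule.mem_span_singleton

theorem apply_eq_zero_of_mem_scalarIdeal {x : Matrix (Fin n) (Fin n) k}
    (hx : x ∈ scalarIdeal k n) {i j : Fin n} (hij : i ≠ j) : x i j = 0 := by
  obtain ⟨c, rfl⟩ := mem_scalarIdeal.1 hx
  simp [hij]

theorem mem_scalarIdeal_of_forall {x : Matrix (Fin n) (Fin n) k}
    (h : ∀ i j, i ≠ j → x i j = 0 ∧ x i i = x j j) : x ∈ scalarIdeal k n := by
  rw [mem_scalarIdeal]
  rcases isEmpty_or_nonempty (Fin n) with hn | ⟨⟨i₀⟩⟩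
  · exact ⟨0, Matrix.ext fun i => isEmptyElim i⟩
  refine ⟨x i₀ i₀, Matrix.ext fun i j => ?_⟩
  obtain rfl | hij := eq_or_ne i j
  · obtain rfl | hi := eq_or_ne i₀ i
    · simp
    · simp [(h _ _ hi).2]
  · simp [hij, (h _ _ hij).1]

theorem single_notMem_scalarIdeal {i j : Fin n} (hij : i ≠ j) {c : k} (hc : c ≠ 0) :
    Matrix.single i j c ∉ scalarIdeal k n := fun h =>
  hc (by simpa using apply_eq_zero_of_mem_scalarIdeal h hij)

theorem PGL.nontrivial_iff : Nontrivial (PGL k n) ↔ 2 ≤ n := by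
  constructor
  · intro h
    by_contra hn
    obtain ⟨x, hx⟩ := exists_ne (0 : PGL k n)
    obtain ⟨x, rfl⟩ := LieSubmodule.Quotient.surjective_mk' _ x
    refine hx ((LieSubmodule.Quotient.mk_eq_zero _).2 (mem_scalarIdeal_of_forall ?_))
    intro i j hij
    exact absurd (Fin.ext (by omega)) hij
  · intro hn
    refine ⟨⟨LieSubmodule.Quotient.mk' _
      (Matrix.single (⟨0, by omega⟩ : Fin n) (⟨1, by omega⟩ : Fin n) (1 : k)), 0, fun h => ?_⟩⟩
    exact single_notMem_scalarIdeal (by simp) one_ne_zero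
      ((LieSubmodule.Quotient.mk_eq_zero _).1 h)

theorem lie_single_single_right {i j l : Fin n} (c d : k) (hil : i ≠ l) :
    ⁅Matrix.single i j c, Matrix.single j l d⁆ = Matrix.single i l (c * d) := by
  simp [LieRing.of_associative_ring_bracket, hil.symm]

/-- Both products of `E_{ij}` and `E_{il}` vanish, so only the two sandwiched terms survive. The
case `j = l` is allowed and is where the factor `2` appears for `n = 2`. -/
theorem lie_lie_single_of_ne (x : Matrix (Fin n) (Fin n) k) {i j l : Fin n} (hij : i ≠ j)
    (hil : i ≠ l) :
    ⁅Matrix.single i j (1 : k), ⁅Matrix.single i l (1 : k), x⁆⁆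
      = -(Matrix.single i l (x j i) + Matrix.single i j (x l i)) := by
  have h1 : Matrix.single i j (1 : k) * (x * Matrix.single i l 1) = Matrix.single i l (x j i) := by
    rw [← mul_assoc]; simp
  have h2 : Matrix.single i l (1 : k) * x * Matrix.single i j 1 = Matrix.single i j (x l i) := by
    simp
  have h3 : x * Matrix.single i l (1 : k) * Matrix.single i j 1 = 0 := by
    rw [mul_assoc]; simp [hil.symm]
  have h4 : Matrix.single i j (1 : k) * (Matrix.single i l 1 * x) = 0 := by
    rw [← mul_assoc]; simp [hij.symm]
  simp only [LieRing.of_associative_ring_bracket, mul_sub, sub_mul, h1, h2, h3, h4]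
  abel

/-- An ideal of `gl(n, k)` which is abelian modulo the scalars consists of scalars, unless `n = 2`
and the characteristic is two. -/
theorem le_scalarIdeal_of_lie_mem (hn : n = 2 → (2 : k) ≠ 0)
    (J : LieIdeal k (Matrix (Fin n) (Fin n) k))
    (hJ : ∀ x ∈ J, ∀ y ∈ J, ⁅x, y⁆ ∈ scalarIdeal k n) : J ≤ scalarIdeal k n := by
  have hl : ∀ y, ∀ x ∈ J, ⁅y, x⁆ ∈ J := fun y x hx => lie_mem_right k _ J y x hx
  have hr : ∀ y, ∀ x ∈ J, ⁅x, y⁆ ∈ J := fun y x hx => lie_mem_left k _ J x y hx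
  have hsmul : ∀ (i j : Fin n) (c : k), c ≠ 0 → Matrix.single i j c ∈ J →
      Matrix.single i j (1 : k) ∈ J := fun i j c hc h => by
    have := J.smul_mem c⁻¹ h
    rwa [Matrix.smul_single, smul_eq_mul, inv_mul_cancel₀ hc] at this
  -- With a third index `j`, the units `E_{ij}` and `E_{jl}` are also in `J`, and their bracket
  -- `E_{il}` is not scalar. For `n = 2` one uses `[[E_{il}, E_{li}], E_{il}] = 2 E_{il}` instead.
  have hsingle : ∀ i l : Fin n, i ≠ l → Matrix.single i l (1 : k) ∉ J := by
    intro i l hil h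
    by_cases hj : ∃ j, j ≠ i ∧ j ≠ l
    · obtain ⟨j, hji, hjl⟩ := hj
      have h1 : Matrix.single i j (1 : k) ∈ J := by
        simpa [lie_single_single_right _ _ hji.symm] using hr (Matrix.single l j (1 : k)) _ h
      have h2 : Matrix.single j l (1 : k) ∈ J := by
        simpa [lie_single_single_right _ _ hjl] using hl (Matrix.single j i (1 : k)) _ h
      have h3 := hJ _ h1 _ h2
      rw [lie_single_single_right _ _ hil] at h3
      exact single_notMem_scalarIdeal hil (by simp) h3
    · have hn2 : n = 2 := by
        push Not at hj
        have h1 : (Finset.univ : Finset (Fin n)) = {i, l} := by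
          ext j
          by_cases h : j = i
          · simp [h]
          · simp [hj j h]
        have := congrArg Finset.card h1
        rwa [Finset.card_univ, Fintype.card_fin, Finset.card_pair hil] at this
      have h1 : ⁅⁅Matrix.single i l (1 : k), Matrix.single l i (1 : k)⁆, Matrix.single i l (1 : k)⁆
          = Matrix.single i l (2 : k) := by
        simp [LieRing.of_associative_ring_bracket, sub_mul, mul_sub, hil.symm,
          ← Matrix.single_add, one_add_one_eq_two]
      have h2 := hJ _ (hr (Matrix.single l i (1 : k)) _ h) _ h
      rw [h1] at h2
      exact single_notMem_scalarIdeal hil (hn hn2) h2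
  -- A nonzero entry `x j i` would produce a matrix unit in `J`: bracket with `E_{il}` and `E_{ij}`,
  -- then with `E_{ll}` to remove the `E_{ij}` term. For `n = 2`, bracketing twice with `E_{ij}`
  -- gives `-2 x_{ji} E_{ij}`.
  have hoff : ∀ x ∈ J, ∀ i j : Fin n, i ≠ j → x j i = 0 := by
    intro x hx i j hij
    by_contra hne
    by_cases hl' : ∃ l, l ≠ i ∧ l ≠ j
    · obtain ⟨l, hli, hlj⟩ := hl'
      have h1 := hr (Matrix.single l l (1 : k)) _ (hl (Matrix.single i j (1 : k)) _
        (hl (Matrix.single i l (1 : k)) _ hx))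
      rw [lie_lie_single_of_ne x hij hli.symm] at h1
      have h2 : ⁅-(Matrix.single i l (x j i) + Matrix.single i j (x l i)),
          Matrix.single l l (1 : k)⁆ = Matrix.single i l (-(x j i)) := by
        simp [LieRing.of_associative_ring_bracket, add_mul, mul_add, hli, hlj.symm,
          Matrix.single_neg]
      rw [h2] at h1
      exact hsingle _ _ hli.symm (hsmul _ _ _ (neg_ne_zero.2 hne) h1)
    · have hn2 : n = 2 := by
        push Not at hl'
        have h1 : (Finset.univ : Finset (Fin n)) = {i, j} := by
          ext l
          by_cases h : l = i
          · simp [h]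
          · simp [hl' l h]
        have := congrArg Finset.card h1
        rwa [Finset.card_univ, Fintype.card_fin, Finset.card_pair hij] at this
      have h1 := hl (Matrix.single i j (1 : k)) _ (hl (Matrix.single i j (1 : k)) _ hx)
      rw [lie_lie_single_of_ne x hij hij, ← Matrix.single_add, ← two_mul, neg_mem_iff] at h1
      exact hsingle _ _ hij (hsmul _ _ _ (mul_ne_zero (hn hn2) hne) h1)
  intro x hx
  refine mem_scalarIdeal_of_forall fun i j hij => ⟨hoff x hx j i hij.symm, ?_⟩
  -- The `(i, j)` entry of `[x, E_{ij}]` is `x i i - x j j`.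
  have h1 := hoff _ (hr (Matrix.single i j (1 : k)) _ hx) j i hij.symm
  simpa [LieRing.of_associative_ring_bracket, sub_eq_zero] using h1

theorem PGL.radical_eq_bot (hn : n = 2 → (2 : k) ≠ 0) :
    LieAlgebra.radical k (PGL k n) = ⊥ := by
  rw [radical_eq_bot_iff_forall_abelian]
  intro I hI x hx
  obtain ⟨x, rfl⟩ := LieSubmodule.Quotient.surjective_mk' _ x
  refine (LieSubmodule.Quotient.mk_eq_zero _).2 ?_
  let J : LieIdeal k (Matrix (Fin n) (Fin n) k) :=
    { (I : Submodule k (PGL k n)).comap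
        (LieSubmodule.Quotient.mk' (scalarIdeal k n) : _ →ₗ[k] PGL k n) with
      lie_mem := fun {y a} ha => lie_mem_right k _ I (LieSubmodule.Quotient.mk' _ y) _ ha }
  refine le_scalarIdeal_of_lie_mem hn J (fun a ha b hb => ?_) hx
  exact (LieSubmodule.Quotient.mk_eq_zero _).1 (hI _ ha _ hb)

/-- In characteristic two a trace zero `2 × 2` matrix has equal diagonal entries, and the bracket of
two such matrices is scalar. So `sl(2)` modulo scalars is an abelian ideal, nonzero because it
contains the class of `E_{01}`. -/
theorem PGL.radical_ne_bot_of_two (hn : n = 2) (h2 : (2 : k) = 0) :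
    LieAlgebra.radical k (PGL k n) ≠ ⊥ := by
  subst hn
  rw [Ne, radical_eq_bot_iff_forall_abelian]
  intro h
  let I : LieIdeal k (PGL k 2) :=
    { (LinearMap.ker (Matrix.traceLinearMap (Fin 2) k k)).map
        (LieSubmodule.Quotient.mk' (scalarIdeal k 2) : _ →ₗ[k] PGL k 2) with
      lie_mem := by
        rintro y _ ⟨a, -, rfl⟩
        obtain ⟨y, rfl⟩ := LieSubmodule.Quotient.surjective_mk' _ y
        refine ⟨⁅y, a⁆, ?_, rfl⟩
        rw [SetLike.mem_coe, LinearMap.mem_ker, Matrix.traceLinearMap_apply,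
          LieRing.of_associative_ring_bracket, Matrix.trace_sub, Matrix.trace_mul_comm, sub_self] }
  have hne := single_notMem_scalarIdeal (k := k) (i := (0 : Fin 2)) (j := 1) (by simp)
    (one_ne_zero (α := k))
  refine hne ((LieSubmodule.Quotient.mk_eq_zero _).1 (h I ?_ _ ⟨Matrix.single 0 1 1, ?_, rfl⟩))
  · rintro _ ⟨a, ha, rfl⟩ _ ⟨b, hb, rfl⟩
    refine (LieSubmodule.Quotient.mk_eq_zero (scalarIdeal k 2) (m := ⁅a, b⁆)).2 ?_
    rw [SetLike.mem_coe, LinearMap.mem_ker, Matrix.traceLinearMap_apply,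
      Matrix.trace_fin_two] at ha hb
    have ha' : a 0 0 = a 1 1 := by linear_combination ha - a 1 1 * h2
    have hb' : b 0 0 = b 1 1 := by linear_combination hb - b 1 1 * h2
    refine mem_scalarIdeal.2 ⟨⁅a, b⁆ 0 0, ?_⟩
    ext i j
    fin_cases i <;> fin_cases j <;>
      simp [LieRing.of_associative_ring_bracket, Matrix.mul_apply, Fin.sum_univ_two, ha', hb']
    · ring
    · ring
    · linear_combination (a 0 1 * b 1 0 - a 1 0 * b 0 1) * h2
  · simp

end ProjectiveLinear

/-! ### Lie algebras of matrices spanned by matrix units -/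

section MatrixUnits

attribute [local instance] LieRing.ofAssociativeRing LieAlgebra.ofAssociativeAlgebra

variable {k : Type*} [Field k] {L : Type*} [LieRing L] [LieAlgebra k L]
  {ι : Type*} [Fintype ι] [DecidableEq ι]

/-- The relation `a ≤ b`: the matrix unit `E_{ba}` is in the image of `M`. -/
def MatrixUnitLE (M : L →ₗ⁅k⁆ Matrix ι ι k) (a b : ι) : Prop :=
  ∃ D : L, M D = Matrix.single b a 1

variable {M : L →ₗ⁅k⁆ Matrix ι ι k}

theorem MatrixUnitLE.trans (hE : ∀ a, MatrixUnitLE M a a) {a b c : ι} (hab : MatrixUnitLE M a b)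
    (hbc : MatrixUnitLE M b c) : MatrixUnitLE M a c := by
  obtain rfl | hac := eq_or_ne a c
  · exact hE a
  obtain ⟨D, hD⟩ := hab
  obtain ⟨D', hD'⟩ := hbc
  refine ⟨⁅D', D⁆, ?_⟩
  rw [LieHom.map_lie, hD, hD', LieRing.of_associative_ring_bracket]
  simp [hac]

theorem lie_apply_ne_zero {X Y : Matrix ι ι k} {b a : ι} (h : ⁅X, Y⁆ b a ≠ 0) :
    (∃ c, X b c ≠ 0 ∧ Y c a ≠ 0) ∨ ∃ c, Y b c ≠ 0 ∧ X c a ≠ 0 := by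
  by_contra! hc
  refine h ?_
  rw [LieRing.of_associative_ring_bracket, Matrix.sub_apply, Matrix.mul_apply, Matrix.mul_apply,
    Finset.sum_eq_zero, Finset.sum_eq_zero, sub_zero]
  · intro c _
    by_contra h'
    exact right_ne_zero_of_mul h' (hc.2 c (left_ne_zero_of_mul h'))
  · intro c _
    by_contra h'
    exact right_ne_zero_of_mul h' (hc.1 c (left_ne_zero_of_mul h'))

variable {K : LieIdeal k L}

/-- If `a ≤ b` strictly, some `E_{ma}` lifts with `m` maximal and `a` not. The units leading from
non-maximal to maximal indices span an abelian ideal of the image, so `E_{ma}` would come from `K`,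
whose matrices are diagonal. -/
theorem MatrixUnitLE.symm_of_radical_eq_bot (hK : LieAlgebra.radical k (L ⧸ K) = ⊥)
    (hker : ∀ D, M D = 0 → D ∈ K) (hdiag : ∀ D ∈ K, ∀ a b, a ≠ b → M D b a = 0)
    (hE : ∀ a, MatrixUnitLE M a a) (hext : ∀ D a b, M D b a ≠ 0 → MatrixUnitLE M a b)
    {a b : ι} (hab : MatrixUnitLE M a b) : MatrixUnitLE M b a := by
  by_contra hba
  have htrans : ∀ {a b c}, MatrixUnitLE M a b → MatrixUnitLE M b c → MatrixUnitLE M a c :=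
    fun h h' => MatrixUnitLE.trans hE h h'
  let _ : Preorder ι :=
    { le := MatrixUnitLE M
      le_refl := hE
      le_trans := fun _ _ _ => htrans }
  -- An element maximal among those strictly above `a` is maximal in the whole preorder.
  obtain ⟨m, ⟨ham, hma⟩, hm⟩ := (Set.toFinite {c : ι | a ≤ c ∧ ¬ c ≤ a}).exists_maximal
    ⟨b, hab, hba⟩
  have hmax : ∀ c, MatrixUnitLE M m c → MatrixUnitLE M c m := fun c hc =>
    hm ⟨htrans ham hc, fun hca => hma (htrans hc hca)⟩ hc
  let isMax : ι → Prop := fun b => ∀ c, MatrixUnitLE M b c → MatrixUnitLE M c b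
  have hisMax : ∀ {b c}, isMax b → MatrixUnitLE M b c → isMax c := fun {b c} hb hbc d hcd =>
    htrans (hb d (htrans hbc hcd)) hbc
  let U : LieIdeal k L :=
    { carrier := {D | ∀ b a, M D b a ≠ 0 → isMax b ∧ ¬ isMax a}
      add_mem' := fun {x y} hx hy b a h => by
        by_cases hxa : M x b a = 0
        · refine hy b a fun hya => h ?_
          rw [map_add, Matrix.add_apply, hxa, hya, add_zero]
        · exact hx b a hxa
      zero_mem' := fun b a h => absurd (by rw [map_zero, Matrix.zero_apply]) h
      smul_mem' := fun c x hx b a h => hx b a fun hxa => h (by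
        rw [map_smul, Matrix.smul_apply, hxa, smul_zero])
      lie_mem := fun {y x} hx b a h => by
        rw [LieHom.map_lie] at h
        rcases lie_apply_ne_zero h with ⟨c, hc, hc'⟩ | ⟨c, hc, hc'⟩
        · exact ⟨hisMax (hx _ _ hc').1 (hext _ _ _ hc), (hx _ _ hc').2⟩
        · exact ⟨(hx _ _ hc).1, fun ha => (hx _ _ hc).2 (hisMax ha (hext _ _ _ hc'))⟩ }
  -- In a product of two matrices from `U` the middle index would be both maximal and non-maximal,
  -- so all brackets lie in the kernel of `M`.
  have hU : U ≤ K := by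
    refine LieIdeal.le_of_lie_mem_of_radical_quotient_eq_bot hK U fun x hx y hy => hker _ ?_
    ext b a
    by_contra h
    rw [LieHom.map_lie] at h
    rcases lie_apply_ne_zero h with ⟨c, hc, hc'⟩ | ⟨c, hc, hc'⟩
    · exact (hx _ _ hc).2 (hy _ _ hc').1
    · exact (hy _ _ hc).2 (hx _ _ hc').1
  obtain ⟨D, hD⟩ := id ham
  have hDU : D ∈ U := by
    intro c d hcd
    rw [hD, Matrix.single_apply] at hcd
    obtain ⟨rfl, rfl⟩ := (ite_ne_right_iff.1 hcd).1
    exact ⟨hmax, fun h => hma (h _ ham)⟩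
  have := hdiag D (hU hDU) a m (fun h => hma (by rw [h]))
  rw [hD, Matrix.single_apply_same] at this
  exact one_ne_zero this

open scoped Classical in
-- Diagonal matrices constant on the equivalence classes commute with the whole image. Their
-- preimage is thus an ideal that is abelian modulo the kernel, and it lies in `K`.
theorem exists_mem_map_eq_diagonal (hK : LieAlgebra.radical k (L ⧸ K) = ⊥)
    (hker : ∀ D, M D = 0 → D ∈ K) (hE : ∀ a, MatrixUnitLE M a a)
    (hext : ∀ D a b, M D b a ≠ 0 → MatrixUnitLE M a b)
    (hsymm : ∀ a b, MatrixUnitLE M a b → MatrixUnitLE M b a) (a : ι) :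
    ∃ D ∈ K, M D = Matrix.diagonal fun b => if MatrixUnitLE M a b then 1 else 0 := by
  have hlie : ∀ x D : L, (∀ b c, b ≠ c → M D b c = 0) →
      (∀ b c, MatrixUnitLE M b c → M D b b = M D c c) → M ⁅x, D⁆ = 0 := by
    intro x D hD hD'
    have hd : M D = Matrix.diagonal fun b => M D b b := by
      ext b c
      obtain rfl | h := eq_or_ne b c
      · rw [Matrix.diagonal_apply_eq]
      · rw [Matrix.diagonal_apply_ne _ h, hD _ _ h]
    ext b c
    rw [LieHom.map_lie, LieRing.of_associative_ring_bracket, hd, Matrix.sub_apply,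
      Matrix.mul_diagonal, Matrix.diagonal_mul, Matrix.zero_apply, mul_comm, ← sub_mul]
    by_cases h : M x b c = 0
    · rw [h, mul_zero]
    · rw [hD' _ _ (hext _ _ _ h), sub_self, zero_mul]
  let C : LieIdeal k L :=
    { carrier := {D | (∀ b c, b ≠ c → M D b c = 0) ∧
        ∀ b c, MatrixUnitLE M b c → M D b b = M D c c}
      add_mem' := fun {x y} hx hy => by
        refine ⟨fun b c h => ?_, fun b c h => ?_⟩
        · rw [map_add, Matrix.add_apply, hx.1 b c h, hy.1 b c h, add_zero]
        · rw [map_add, Matrix.add_apply, Matrix.add_apply, hx.2 b c h, hy.2 b c h]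
      zero_mem' := ⟨fun b c _ => by rw [map_zero, Matrix.zero_apply],
        fun b c _ => by rw [map_zero, Matrix.zero_apply, Matrix.zero_apply]⟩
      smul_mem' := fun r x hx => by
        refine ⟨fun b c h => ?_, fun b c h => ?_⟩
        · rw [map_smul, Matrix.smul_apply, hx.1 b c h, smul_zero]
        · rw [map_smul, Matrix.smul_apply, Matrix.smul_apply, hx.2 b c h]
      lie_mem := fun {y x} hx => by
        have h0 : M ⁅y, x⁆ = 0 := hlie y x hx.1 hx.2
        exact ⟨fun b c _ => by rw [h0, Matrix.zero_apply],
          fun b c _ => by rw [h0, Matrix.zero_apply, Matrix.zero_apply]⟩ }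
  have hC : C ≤ K := LieIdeal.le_of_lie_mem_of_radical_quotient_eq_bot hK C
    fun x _ y hy => hker _ (hlie x y hy.1 hy.2)
  choose E hE' using hE
  have hM : M (∑ b with MatrixUnitLE M a b, E b)
      = Matrix.diagonal fun b => if MatrixUnitLE M a b then 1 else 0 := by
    rw [← LieHom.coe_toLinearMap, map_sum]
    ext b c
    rw [Matrix.sum_apply]
    simp only [LieHom.coe_toLinearMap, hE', Matrix.single_apply, Matrix.diagonal_apply,
      Finset.sum_filter]
    obtain rfl | h := eq_or_ne b c
    · rw [Finset.sum_eq_single b] <;> simp +contextual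
    · rw [if_neg h]
      refine Finset.sum_eq_zero fun d _ => ?_
      split_ifs with h1 h2
      · exact absurd (h2.1.symm.trans h2.2) h
      · rfl
      · rfl
  refine ⟨_, hC ?_, hM⟩
  refine ⟨fun b c h => ?_, fun b c h => ?_⟩
  · rw [hM, Matrix.diagonal_apply_ne _ h]
  · rw [hM, Matrix.diagonal_apply_eq, Matrix.diagonal_apply_eq]
    have : MatrixUnitLE M a b ↔ MatrixUnitLE M a c :=
      ⟨fun h' => h'.trans (fun x => ⟨E x, hE' x⟩) h,
        fun h' => h'.trans (fun x => ⟨E x, hE' x⟩) (hsymm _ _ h)⟩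
    simp only [this]

end MatrixUnits

/-! ### Paths in a monomial algebra -/

section PathFacts

variable {V : Type u} [Quiver.{v} V]

theorem mem_nonzeroPaths_of_comp {Z : PathSet V} {a b c d : V} {l : Path a b} {p : Path b c}
    {r : Path c d} (h : (l.comp p).comp r ∈ nonzeroPaths Z a d) : p ∈ nonzeroPaths Z b c := by
  intro e f l' q r' hq hp
  refine h e f (l.comp l') q (r'.comp r) hq ?_
  rw [← hp]
  simp only [Path.comp_assoc]

theorem notMem_nonzeroPaths {Z : PathSet V} {a b : V} {p : Path a b} (hp : p ∈ Z a b) :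
    p ∉ nonzeroPaths Z a b := fun h =>
  h a b Path.nil p Path.nil hp (by rw [Path.nil_comp, Path.comp_nil])

theorem mem_nonzeroPaths_of_length {Z : PathSet V} (hZ : IsMinimalRelations Z) {a b : V}
    {p : Path a b} (hp : p.length ≤ 1) : p ∈ nonzeroPaths Z a b := by
  intro c d l q r hq h
  have h1 := hZ.two_le_length q hq
  have h2 := congrArg Path.length h
  simp only [Path.length_comp] at h2
  omega

theorem toPath_injective {a b : V} : Function.Injective (Quiver.Hom.toPath : (a ⟶ b) → Path a b) :=
  fun e f h => by
    have := Path.hom_heq_of_cons_eq_cons h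
    exact eq_of_heq this

end PathFacts

/-- The coefficient of a path in an element of the path algebra. -/
def PathAlgebra.coef (k : Type w) [Field k] {V : Type u} [Quiver.{v} V] (η : QuiverPath V) :
    PathAlgebra k V →ₗ[k] k :=
  (Finsupp.lapply η : (QuiverPath V →₀ k) →ₗ[k] k)

namespace MonomialAlgebra

variable (k : Type w) [Field k] {V : Type u} [Quiver.{v} V] [Fintype V] (Z : PathSet V)

/-- The projection of the path algebra onto the monomial algebra. -/
def proj : PathAlgebra k V →ₐ[k] MonomialAlgebra k Z :=
  Ideal.Quotient.mkₐ k (relationIdeal k Z).asIdeal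

theorem proj_surjective : Function.Surjective (proj k Z) :=
  Ideal.Quotient.mkₐ_surjective k _

theorem proj_eq_zero_iff {x : PathAlgebra k V} : proj k Z x = 0 ↔ x ∈ relationIdeal k Z :=
  Ideal.Quotient.eq_zero_iff_mem.trans TwoSidedIdeal.mem_asIdeal

/-- The image of a path in the monomial algebra. -/
def ofPath {a b : V} (p : Path a b) : MonomialAlgebra k Z := proj k Z (PathAlgebra.of k p)

variable {k Z}

theorem ofPath_mul_ofPath {a b c : V} (β : Path b c) (α : Path a b) :
    ofPath k Z β * ofPath k Z α = ofPath k Z (α.comp β) := by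
  rw [ofPath, ofPath, ← map_mul, PathAlgebra.of_mul_of_comp, ofPath]

theorem ofPath_mul_ofPath_of_ne {a b c d : V} (β : Path c d) (α : Path a b) (h : b ≠ c) :
    ofPath k Z β * ofPath k Z α = 0 := by
  rw [ofPath, ofPath, ← map_mul, PathAlgebra.of_mul_of_ne _ _ h, map_zero]

theorem ofPath_cons {a b c : V} (p : Path a b) (e : b ⟶ c) :
    ofPath k Z (p.cons e) = ofPath k Z e.toPath * ofPath k Z p := by
  rw [ofPath_mul_ofPath, Path.comp_toPath_eq_cons]

theorem one_eq_sum : (1 : MonomialAlgebra k Z) = ∑ e : V, ofPath k Z (Path.nil : Path e e) := by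
  rw [← map_one (proj k Z), PathAlgebra.one_def, map_sum]
  rfl

theorem ofPath_of_mem {a b : V} {p : Path a b} (hp : p ∈ Z a b) : ofPath k Z p = 0 :=
  (proj_eq_zero_iff k Z).2 (TwoSidedIdeal.subset_span ⟨a, b, p, hp, rfl⟩)

theorem ofPath_of_notMem {a b : V} {p : Path a b} (hp : p ∉ nonzeroPaths Z a b) :
    ofPath k Z p = 0 := by
  simp only [nonzeroPaths, Set.mem_ofPred_eq, not_forall, not_not] at hp
  obtain ⟨c, d, l, q, r, hq, rfl⟩ := hp
  rw [← ofPath_mul_ofPath, ← ofPath_mul_ofPath, ofPath_of_mem hq, zero_mul, mul_zero]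

/-- The paths outside `B` span a two-sided ideal which contains `Z`, so the relation ideal involves
no path of `B`. This makes the coefficients of the paths of `B` well defined in the quotient. -/
theorem apply_eq_zero_of_mem_relationIdeal {x : PathAlgebra k V} (hx : x ∈ relationIdeal k Z)
    {η : QuiverPath V} (hη : η.2.2 ∈ nonzeroPaths Z η.1 η.2.1) :
    PathAlgebra.coef k η x = 0 := by
  let S : Submodule k (PathAlgebra k V) :=
    Finsupp.supported k k {η : QuiverPath V | η.2.2 ∉ nonzeroPaths Z η.1 η.2.1}
  have hof : ∀ {a b : V} {p : Path a b}, p ∉ nonzeroPaths Z a b → PathAlgebra.of k p ∈ S :=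
    fun hp => Finsupp.single_mem_supported k _ hp
  have hmem : ∀ y z, z ∈ S → y * z ∈ S ∧ z * y ∈ S := by
    intro y z hz
    have hz' : z ∈ Submodule.span k ((fun η : QuiverPath V => PathAlgebra.of k η.2.2) ''
        {η : QuiverPath V | η.2.2 ∉ nonzeroPaths Z η.1 η.2.1}) := by
      have : S = _ := Finsupp.supported_eq_span_single k _
      rw [this] at hz
      exact hz
    clear hz
    induction hz' using Submodule.span_induction with
    | zero => simp only [mul_zero, zero_mul, S.zero_mem, and_self]
    | add a b _ _ ha hb =>
      rw [mul_add, add_mul]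
      exact ⟨S.add_mem ha.1 hb.1, S.add_mem ha.2 hb.2⟩
    | smul c a _ ha =>
      rw [mul_smul_comm, smul_mul_assoc]
      exact ⟨S.smul_mem c ha.1, S.smul_mem c ha.2⟩
    | mem a ha =>
      obtain ⟨⟨a, b, p⟩, hp, rfl⟩ := ha
      induction y using PathAlgebra.induction_on with
      | h0 => simp only [mul_zero, zero_mul, S.zero_mem, and_self]
      | hadd a b ha hb =>
        rw [mul_add, add_mul]
        exact ⟨S.add_mem ha.1 hb.1, S.add_mem ha.2 hb.2⟩
      | @hof r c d q =>
        rw [mul_smul_comm, smul_mul_assoc]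
        refine ⟨S.smul_mem r ?_, S.smul_mem r ?_⟩
        · by_cases h : b = c
          · subst h
            rw [PathAlgebra.of_mul_of_comp]
            refine hof fun h => hp (mem_nonzeroPaths_of_comp (l := Path.nil) (r := q) ?_)
            rwa [Path.nil_comp]
          · rw [PathAlgebra.of_mul_of_ne _ _ h]
            exact S.zero_mem
        · by_cases h : d = a
          · subst h
            rw [PathAlgebra.of_mul_of_comp]
            refine hof fun h => hp (mem_nonzeroPaths_of_comp (l := q) (r := Path.nil) ?_)
            rwa [Path.comp_nil]
          · rw [PathAlgebra.of_mul_of_ne _ _ h]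
            exact S.zero_mem
  let I : TwoSidedIdeal (PathAlgebra k V) := TwoSidedIdeal.mk' S S.zero_mem S.add_mem S.neg_mem
    (fun h => (hmem _ _ h).1) (fun h => (hmem _ _ h).2)
  have hI : relationIdeal k Z ≤ I := by
    refine TwoSidedIdeal.span_le.2 ?_
    rintro _ ⟨a, b, p, hp, rfl⟩
    exact (TwoSidedIdeal.mem_mk' ..).2 (hof (notMem_nonzeroPaths hp))
  have hxS : x ∈ S := (TwoSidedIdeal.mem_mk' ..).1 (hI hx)
  by_contra h
  exact (Finsupp.mem_supported k _).1 hxS (Finsupp.mem_support_iff.2 h) hη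

/-- Any linear section of the projection will do, as two lifts differ by an element that `f` kills.
-/
theorem exists_descend {W : Type*} [AddCommGroup W] [Module k W] (f : PathAlgebra k V →ₗ[k] W)
    (hf : ∀ x ∈ relationIdeal k Z, f x = 0) :
    ∃ g : MonomialAlgebra k Z →ₗ[k] W, ∀ x, g (proj k Z x) = f x := by
  obtain ⟨s, hs⟩ := (proj k Z).toLinearMap.exists_rightInverse_of_surjective
    (LinearMap.range_eq_top.2 (proj_surjective k Z))
  refine ⟨f ∘ₗ s, fun x => ?_⟩
  rw [LinearMap.comp_apply, ← sub_eq_zero, ← map_sub]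
  refine hf _ ((proj_eq_zero_iff k Z).1 ?_)
  rw [map_sub, sub_eq_zero]
  exact LinearMap.congr_fun hs (proj k Z x)

theorem exists_coef (η : QuiverPath V) (hη : η.2.2 ∈ nonzeroPaths Z η.1 η.2.1) :
    ∃ g : MonomialAlgebra k Z →ₗ[k] k, ∀ x, g (proj k Z x) = PathAlgebra.coef k η x :=
  exists_descend (PathAlgebra.coef k η)
    fun _ hx => apply_eq_zero_of_mem_relationIdeal hx hη

open scoped Classical in
/-- The coefficient of a path `η` in an element of the monomial algebra; it is zero if `η` is zero
in the monomial algebra. -/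
def coefAux (η : QuiverPath V) : MonomialAlgebra k Z →ₗ[k] k :=
  if hη : η.2.2 ∈ nonzeroPaths Z η.1 η.2.1 then (exists_coef η hη).choose else 0

/-- The coefficient of a path in an element of the monomial algebra. -/
def coef {a b : V} (p : Path a b) : MonomialAlgebra k Z →ₗ[k] k := coefAux ⟨a, b, p⟩

theorem coef_proj {a b : V} {p : Path a b} (hp : p ∈ nonzeroPaths Z a b) (x : PathAlgebra k V) :
    coef p (proj k Z x) = PathAlgebra.coef k ⟨a, b, p⟩ x := by
  rw [coef, coefAux, dif_pos hp]
  exact (exists_coef ⟨a, b, p⟩ hp).choose_spec x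

theorem coef_of_notMem {a b : V} {p : Path a b} (hp : p ∉ nonzeroPaths Z a b)
    (x : MonomialAlgebra k Z) : coef p x = 0 := by
  rw [coef, coefAux, dif_neg hp, LinearMap.zero_apply]

theorem coef_ofPath_self {a b : V} {p : Path a b} (hp : p ∈ nonzeroPaths Z a b) :
    coef p (ofPath k Z p) = 1 := by
  rw [ofPath, coef_proj hp]
  exact Finsupp.single_eq_same

theorem coef_ofPath_of_ne {a b c d : V} {p : Path a b} {q : Path c d}
    (h : (⟨a, b, p⟩ : QuiverPath V) ≠ ⟨c, d, q⟩) : coef p (ofPath k Z q) = 0 := by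
  by_cases hp : p ∈ nonzeroPaths Z a b
  · rw [ofPath, coef_proj hp]
    exact Finsupp.single_eq_of_ne h
  · exact coef_of_notMem hp _

open scoped Classical in
theorem coef_ofPath {a b c d : V} {p : Path a b} (hp : p ∈ nonzeroPaths Z a b) (q : Path c d) :
    coef p (ofPath k Z q) = if (⟨a, b, p⟩ : QuiverPath V) = ⟨c, d, q⟩ then 1 else 0 := by
  split_ifs with h
  · cases h
    exact coef_ofPath_self hp
  · exact coef_ofPath_of_ne h

/-- An element of the monomial algebra is a finite linear combination of paths, the coefficients
being the values of the functions `coef`. -/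
theorem exists_eq_sum (x : MonomialAlgebra k Z) :
    ∃ s : Finset (QuiverPath V), x = ∑ η ∈ s, coef η.2.2 x • ofPath k Z η.2.2 := by
  obtain ⟨y, rfl⟩ := proj_surjective k Z x
  refine ⟨(show QuiverPath V →₀ k from y).support, ?_⟩
  have hy : y = ∑ η ∈ (show QuiverPath V →₀ k from y).support,
      PathAlgebra.coef k η y • PathAlgebra.of k η.2.2 := by
    refine Eq.trans (Finsupp.sum_single (show QuiverPath V →₀ k from y)).symm
      (Finset.sum_congr rfl fun η _ => ?_)
    exact ((Finsupp.smul_single _ _ _).trans (by rw [smul_eq_mul, mul_one]; rfl)).symm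
  conv_lhs => rw [hy, map_sum]
  refine Finset.sum_congr rfl fun η _ => ?_
  rw [map_smul]
  change _ • ofPath k Z η.2.2 = _
  by_cases hη : η.2.2 ∈ nonzeroPaths Z η.1 η.2.1
  · rw [coef_proj hη]
  · rw [ofPath_of_notMem hη, smul_zero, smul_zero]

theorem induction_on {P : MonomialAlgebra k Z → Prop} (x : MonomialAlgebra k Z) (h0 : P 0)
    (hadd : ∀ x y, P x → P y → P (x + y))
    (hof : ∀ (c : k) {a b : V} (p : Path a b), P (c • ofPath k Z p)) : P x := by
  obtain ⟨s, hs⟩ := exists_eq_sum x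
  rw [hs]
  exact Finset.sum_induction _ P hadd h0 fun η _ => hof _ _

theorem linearMap_ext {W : Type*} [AddCommGroup W] [Module k W]
    {f g : MonomialAlgebra k Z →ₗ[k] W}
    (h : ∀ {a b : V} (p : Path a b), f (ofPath k Z p) = g (ofPath k Z p)) : f = g := by
  refine LinearMap.ext fun x => ?_
  induction x using induction_on with
  | h0 => rw [map_zero, map_zero]
  | hadd x y hx hy => rw [map_add, map_add, hx, hy]
  | hof c p => rw [map_smul, map_smul, h]

/-- Left multiplication by `q` appends `q` after a path, so only paths ending in `q` can occur;
right multiplication likewise prepends. -/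
theorem coef_mul_eq_zero_of_forall {a b c d : V} {p : Path a b} {q : Path c d}
    (h : ∀ {e : V} (γ : Path e c), (⟨a, b, p⟩ : QuiverPath V) ≠ ⟨e, d, γ.comp q⟩)
    (x : MonomialAlgebra k Z) : coef p (ofPath k Z q * x) = 0 := by
  have key : coef p ∘ₗ LinearMap.mulLeft k (ofPath k Z q) = 0 := linearMap_ext fun {e f} γ => by
    rw [LinearMap.comp_apply, LinearMap.mulLeft_apply, LinearMap.zero_apply]
    by_cases hf : f = c
    · subst hf
      rw [ofPath_mul_ofPath, coef_ofPath_of_ne (h γ)]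
    · rw [ofPath_mul_ofPath_of_ne _ _ hf, map_zero]
  exact LinearMap.congr_fun key x

theorem coef_mul_eq_zero_of_forall' {a b c d : V} {p : Path a b} {q : Path c d}
    (h : ∀ {e : V} (γ : Path d e), (⟨a, b, p⟩ : QuiverPath V) ≠ ⟨c, e, q.comp γ⟩)
    (x : MonomialAlgebra k Z) : coef p (x * ofPath k Z q) = 0 := by
  have key : coef p ∘ₗ LinearMap.mulRight k (ofPath k Z q) = 0 := linearMap_ext fun {e f} γ => by
    rw [LinearMap.comp_apply, LinearMap.mulRight_apply, LinearMap.zero_apply]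
    by_cases he : d = e
    · subst he
      rw [ofPath_mul_ofPath, coef_ofPath_of_ne (h γ)]
    · rw [ofPath_mul_ofPath_of_ne _ _ he, map_zero]
  exact LinearMap.congr_fun key x

/-- Appending `r` is injective on paths, so nothing else contributes to the coefficient of `p.comp
r`; membership in `B` keeps that path from being zero. -/
theorem coef_comp_mul {a b c : V} {p : Path a b} {r : Path b c}
    (h : p.comp r ∈ nonzeroPaths Z a c) (x : MonomialAlgebra k Z) :
    coef (p.comp r) (ofPath k Z r * x) = coef p x := by
  have hp : p ∈ nonzeroPaths Z a b :=
    mem_nonzeroPaths_of_comp (l := Path.nil) (r := r) (by rwa [Path.nil_comp])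
  have key : coef (p.comp r) ∘ₗ LinearMap.mulLeft k (ofPath k Z r) = coef p :=
    linearMap_ext fun {e f} γ => by
      rw [LinearMap.comp_apply, LinearMap.mulLeft_apply]
      by_cases hf : f = b
      · subst hf
        rw [ofPath_mul_ofPath, coef_ofPath h, coef_ofPath hp]
        congr 1
        by_cases he : a = e
        · subst he
          simp
        · exact propext ⟨fun h' => absurd (congrArg Sigma.fst h') he,
            fun h' => absurd (congrArg Sigma.fst h') he⟩
      · rw [ofPath_mul_ofPath_of_ne _ _ hf, map_zero, coef_ofPath_of_ne]
        exact fun h' => hf (congrArg (fun η : QuiverPath V => η.2.1) h').symm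
  exact LinearMap.congr_fun key x

theorem coef_comp_mul_right {a b c : V} {l : Path a b} {p : Path b c}
    (h : l.comp p ∈ nonzeroPaths Z a c) (x : MonomialAlgebra k Z) :
    coef (l.comp p) (x * ofPath k Z l) = coef p x := by
  have hp : p ∈ nonzeroPaths Z b c :=
    mem_nonzeroPaths_of_comp (l := l) (r := Path.nil) (by rwa [Path.comp_nil])
  have key : coef (l.comp p) ∘ₗ LinearMap.mulRight k (ofPath k Z l) = coef p :=
    linearMap_ext fun {e f} γ => by
      rw [LinearMap.comp_apply, LinearMap.mulRight_apply]
      by_cases he : b = e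
      · subst he
        rw [ofPath_mul_ofPath, coef_ofPath h, coef_ofPath hp]
        congr 1
        by_cases hf : c = f
        · subst hf
          simp
        · exact propext
            ⟨fun h' => absurd (congrArg (fun η : QuiverPath V => η.2.1) h') hf,
              fun h' => absurd (congrArg (fun η : QuiverPath V => η.2.1) h') hf⟩
      · rw [ofPath_mul_ofPath_of_ne _ _ he, map_zero, coef_ofPath_of_ne]
        exact fun h' => he (congrArg Sigma.fst h')
  exact LinearMap.congr_fun key x

/-- The span of the paths of length at least `n`, that is, the `n`-th power of the ideal generated
by the arrows. -/
def arrowPow (n : ℕ) : Submodule k (MonomialAlgebra k Z) :=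
  Submodule.span k {x | ∃ (a b : V) (p : Path a b), n ≤ p.length ∧ x = ofPath k Z p}

theorem ofPath_mem_arrowPow {a b : V} (p : Path a b) {n : ℕ} (hp : n ≤ p.length) :
    ofPath k Z p ∈ (arrowPow n : Submodule k (MonomialAlgebra k Z)) :=
  Submodule.subset_span ⟨a, b, p, hp, rfl⟩

theorem mem_arrowPow_iff {n : ℕ} {x : MonomialAlgebra k Z} :
    x ∈ arrowPow n ↔ ∀ {a b : V} (p : Path a b), p.length < n → coef p x = 0 := by
  constructor
  · intro hx a b p hp
    induction hx using Submodule.span_induction with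
    | zero => rw [map_zero]
    | add x y _ _ hx hy => rw [map_add, hx, hy, add_zero]
    | smul c x _ hx => rw [map_smul, hx, smul_zero]
    | mem x hx =>
      obtain ⟨c, d, q, hq, rfl⟩ := hx
      refine coef_ofPath_of_ne fun h => ?_
      have : p.length = q.length := congrArg (fun η : QuiverPath V => η.2.2.length) h
      omega
  · intro h
    obtain ⟨s, hs⟩ := exists_eq_sum x
    rw [hs]
    refine Submodule.sum_mem _ fun η _ => ?_
    by_cases hη : η.2.2.length < n
    · rw [h _ hη, zero_smul]
      exact Submodule.zero_mem _
    · exact Submodule.smul_mem _ _ (ofPath_mem_arrowPow _ (not_lt.1 hη))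

theorem mul_mem_arrowPow {m n : ℕ} {x y : MonomialAlgebra k Z} (hx : x ∈ arrowPow m)
    (hy : y ∈ arrowPow n) : x * y ∈ arrowPow (m + n) := by
  induction hx using Submodule.span_induction with
  | zero => rw [zero_mul]; exact Submodule.zero_mem _
  | add x y _ _ hx hy => rw [add_mul]; exact Submodule.add_mem _ hx hy
  | smul c x _ hx => rw [smul_mul_assoc]; exact Submodule.smul_mem _ _ hx
  | mem x hx =>
    obtain ⟨a, b, p, hp, rfl⟩ := hx
    induction hy using Submodule.span_induction with
    | zero => rw [mul_zero]; exact Submodule.zero_mem _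
    | add x y _ _ hx hy => rw [mul_add]; exact Submodule.add_mem _ hx hy
    | smul c x _ hx => rw [mul_smul_comm]; exact Submodule.smul_mem _ _ hx
    | mem y hy =>
      obtain ⟨c, d, q, hq, rfl⟩ := hy
      by_cases h : d = a
      · subst h
        rw [ofPath_mul_ofPath]
        refine ofPath_mem_arrowPow _ ?_
        rw [Path.length_comp]
        omega
      · rw [ofPath_mul_ofPath_of_ne _ _ h]
        exact Submodule.zero_mem _

theorem arrowPow_antitone {m n : ℕ} (h : m ≤ n) :
    (arrowPow n : Submodule k (MonomialAlgebra k Z)) ≤ arrowPow m := fun _ hx =>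
  mem_arrowPow_iff.2 fun p hp => mem_arrowPow_iff.1 hx p (hp.trans_le h)

theorem mem_arrowPow_zero (x : MonomialAlgebra k Z) : x ∈ arrowPow 0 :=
  mem_arrowPow_iff.2 fun _ hp => absurd hp (Nat.not_lt_zero _)

/-- The paths of `B` are linearly independent in `Λ`, hence finite in number and of bounded length.
-/
theorem exists_arrowPow_eq_bot [FiniteDimensional k (MonomialAlgebra k Z)] :
    ∃ n, ∀ x : MonomialAlgebra k Z, x ∈ arrowPow n → x = 0 := by
  let B : Set (QuiverPath V) := {η | η.2.2 ∈ nonzeroPaths Z η.1 η.2.1}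
  have hli : LinearIndependent k fun η : B => ofPath k Z η.1.2.2 := by
    rw [linearIndependent_iff']
    intro s g hg η hη
    have := congrArg (coef η.1.2.2) hg
    rw [map_zero, map_sum, Finset.sum_eq_single η] at this
    · rwa [map_smul, coef_ofPath_self η.2, smul_eq_mul, mul_one] at this
    · intro η' _ hne
      rw [map_smul, coef_ofPath_of_ne, smul_zero]
      exact fun h => hne (Subtype.ext h.symm)
    · exact fun h => absurd hη h
  have : Finite B := hli.finite
  obtain ⟨n, hn⟩ := ((Set.toFinite B).image fun η => η.2.2.length).bddAbove
  refine ⟨n + 1, fun x hx => ?_⟩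
  obtain ⟨s, hs⟩ := exists_eq_sum x
  rw [hs]
  refine Finset.sum_eq_zero fun η _ => ?_
  by_cases hη : η ∈ B
  · rw [mem_arrowPow_iff.1 hx _ (Nat.lt_succ_of_le (hn ⟨η, hη, rfl⟩)), zero_smul]
  · rw [ofPath_of_notMem hη, smul_zero]

end MonomialAlgebra

/-! ### Derivations of a monomial algebra -/

section Appearances

variable {V : Type u} [Quiver.{v} V]

/-- An appearance of an arrow in a path gives an appearance in every longer path. -/
def Appearance.consRight {a b c d m : V} {e : b ⟶ c} {p : Path a m} (e' : m ⟶ d)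
    (x : Appearance e p) : Appearance e (p.cons e') :=
  ⟨(x.1.1, x.1.2.cons e'), by rw [Path.comp_cons, x.2]⟩

theorem Appearance.consRight_injective {a b c d m : V} {e : b ⟶ c} {p : Path a m} (e' : m ⟶ d) :
    Function.Injective (Appearance.consRight e' : Appearance e p → Appearance e (p.cons e')) := by
  rintro ⟨⟨l, r⟩, h⟩ ⟨⟨l', r'⟩, h'⟩ hx
  simpa [Appearance.consRight] using hx

end Appearances

namespace MonomialAlgebra

section Derivations

attribute [local instance] LieRing.ofAssociativeRing LieAlgebra.ofAssociativeAlgebra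

variable {k : Type w} [Field k] {V : Type u} [Quiver.{v} V] [Fintype V] {Z : PathSet V}
  {f : Module.End k (MonomialAlgebra k Z)}

theorem map_mul_of_mem_der (hf : f ∈ hochschildDer k (MonomialAlgebra k Z))
    (x y : MonomialAlgebra k Z) : f (x * y) = x * f y + f x * y := hf x y

/-- Apply `f` to the relation `l e r = 0` and read off the coefficient of `l e' r`. The Leibniz term
with `f l` gives paths ending in `e r`, that with `f r` paths starting with `l e`, so neither
contributes. The middle term contributes exactly the coefficient of `e'` in `f e`. -/
theorem coef_der_arrow_eq_zero_of_mem (hf : f ∈ hochschildDer k (MonomialAlgebra k Z))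
    {a b c d : V} (l : Path a b) (e e' : b ⟶ c) (r : Path c d) (he : e' ≠ e)
    (hp : (l.comp e.toPath).comp r ∈ Z a d)
    (hp' : (l.comp e'.toPath).comp r ∈ nonzeroPaths Z a d) :
    coef e'.toPath (f (ofPath k Z e.toPath)) = 0 := by
  have h0 : coef ((l.comp e'.toPath).comp r) (f (ofPath k Z ((l.comp e.toPath).comp r))) = 0 := by
    rw [ofPath_of_mem hp, map_zero, map_zero]
  have hl : coef ((l.comp e'.toPath).comp r)
      (ofPath k Z r * (ofPath k Z e.toPath * f (ofPath k Z l))) = 0 := by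
    rw [← mul_assoc, ofPath_mul_ofPath]
    refine coef_mul_eq_zero_of_forall (fun {s} γ h => ?_) _
    obtain rfl : a = s := congrArg Sigma.fst h
    have h1 : (l.comp e'.toPath).comp r = γ.comp (e.toPath.comp r) := by simpa using h
    rw [← Path.comp_assoc, Path.comp_inj_left] at h1
    exact he (eq_of_heq (Path.hom_heq_of_cons_eq_cons h1))
  have hr : coef ((l.comp e'.toPath).comp r)
      (f (ofPath k Z r) * ofPath k Z (l.comp e.toPath)) = 0 := by
    refine coef_mul_eq_zero_of_forall' (fun {s} γ h => ?_) _
    obtain rfl : d = s := congrArg (fun η : QuiverPath V => η.2.1) h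
    have h1 : (l.comp e'.toPath).comp r = (l.comp e.toPath).comp γ := by simpa using h
    rw [Path.comp_assoc, Path.comp_assoc, Path.comp_inj_right] at h1
    exact he (toPath_injective ((Path.comp_inj' (p₁ := e'.toPath) (p₂ := e.toPath) rfl).1 h1).1)
  have hp'' : l.comp e'.toPath ∈ nonzeroPaths Z a c :=
    mem_nonzeroPaths_of_comp (l := Path.nil) (r := r) (by rwa [Path.nil_comp])
  rw [← ofPath_mul_ofPath, ← ofPath_mul_ofPath, map_mul_of_mem_der hf, map_mul_of_mem_der hf,
    ofPath_mul_ofPath, map_add, hr, add_zero, mul_add, map_add, hl, zero_add, coef_comp_mul hp',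
    coef_comp_mul_right hp''] at h0
  exact h0

/-- For an idempotent, `f e = e f e + f e e`. The coefficient at its own vertex satisfies `c = c +
c`, so it vanishes in every characteristic. -/
theorem coef_nil_der_vertex (hf : f ∈ hochschildDer k (MonomialAlgebra k Z)) (i j : V) :
    coef (Path.nil : Path j j) (f (ofPath k Z (Path.nil : Path i i))) = 0 := by
  by_cases hn : (Path.nil : Path j j) ∈ nonzeroPaths Z j j
  · have h := congrArg (coef (Path.nil : Path j j)) (map_mul_of_mem_der hf
      (ofPath k Z (Path.nil : Path i i)) (ofPath k Z (Path.nil : Path i i)))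
    rw [ofPath_mul_ofPath, Path.comp_nil, map_add] at h
    by_cases hij : j = i
    · subst hij
      have h1 := coef_comp_mul (p := (Path.nil : Path j j)) (r := Path.nil) hn
        (f (ofPath k Z (Path.nil : Path j j)))
      have h2 := coef_comp_mul_right (p := (Path.nil : Path j j)) (l := Path.nil) hn
        (f (ofPath k Z (Path.nil : Path j j)))
      rw [Path.comp_nil] at h1 h2
      rw [h1, h2] at h
      exact left_eq_add.1 h
    · rw [h, coef_mul_eq_zero_of_forall, coef_mul_eq_zero_of_forall', add_zero]
      · exact fun γ h' => hij (congrArg Sigma.fst h')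
      · exact fun γ h' => hij (congrArg (fun η : QuiverPath V => η.2.1) h')
  · exact coef_of_notMem hn _

/-- Write `e` as its product with the vertex at the end where `p` differs and apply Leibniz. One
term has that vertex as an endpoint; in the other `e` is a factor, and since `p` has length at most
one it would have to be `e` itself. -/
theorem coef_der_arrow_eq_zero_of_not_parallel (hf : f ∈ hochschildDer k (MonomialAlgebra k Z))
    {a b c d : V} (e : a ⟶ b) (p : Path c d) (hp : p.length ≤ 1) (h : c ≠ a ∨ d ≠ b) :
    coef p (f (ofPath k Z e.toPath)) = 0 := by
  rcases h with h | h
  · have h1 : ofPath k Z e.toPath = ofPath k Z e.toPath * ofPath k Z (Path.nil : Path a a) := by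
      rw [ofPath_mul_ofPath, Path.nil_comp]
    rw [h1, map_mul_of_mem_der hf, map_add, coef_mul_eq_zero_of_forall,
      coef_mul_eq_zero_of_forall', add_zero]
    · exact fun γ h' => h (congrArg Sigma.fst h')
    · intro s γ h'
      have h2 := congrArg (fun η : QuiverPath V => η.2.2.length) h'
      simp only [Path.length_comp, Quiver.Path.length_toPath] at h2
      exact h ((congrArg Sigma.fst h').trans (Path.eq_of_length_zero γ (by omega)))
  · have h1 : ofPath k Z e.toPath = ofPath k Z (Path.nil : Path b b) * ofPath k Z e.toPath := by
      rw [ofPath_mul_ofPath, Path.comp_nil]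
    rw [h1, map_mul_of_mem_der hf, map_add, coef_mul_eq_zero_of_forall,
      coef_mul_eq_zero_of_forall', add_zero]
    · intro s γ h'
      have h2 := congrArg (fun η : QuiverPath V => η.2.2.length) h'
      simp only [Path.length_comp, Quiver.Path.length_toPath] at h2
      exact h ((congrArg (fun η : QuiverPath V => η.2.1) h').trans
        (Path.eq_of_length_zero γ (by omega)).symm)
    · exact fun γ h' => h (congrArg (fun η : QuiverPath V => η.2.1) h')

theorem der_vertex_mem_arrowPow (hf : f ∈ hochschildDer k (MonomialAlgebra k Z)) (i : V) :
    f (ofPath k Z (Path.nil : Path i i)) ∈ arrowPow 1 := by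
  rw [mem_arrowPow_iff]
  intro a b p hp
  obtain rfl := Path.eq_of_length_zero p (by omega)
  rw [Path.eq_nil_of_length_zero p (by omega)]
  exact coef_nil_der_vertex hf i a

/-! #### Replacing arrows by paths -/

variable (k Z) in
/-- The sum in the monomial algebra of the paths obtained by replacing one appearance of the arrow
`e` in the path `p` by the path `γ`. -/
def replaceMap {a b c d : V} (p : Path a d) (e : b ⟶ c) (γ : Path b c) : MonomialAlgebra k Z :=
  ∑ᶠ x : Appearance e p, ofPath k Z ((x.1.1.comp γ).comp x.1.2)

theorem coef_replaceMap {a b c d : V} (p : Path a d) (e : b ⟶ c) (γ : Path b c) (η : Path a d)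
    (hη : η ∈ nonzeroPaths Z a d) :
    coef η (replaceMap k Z p e γ) = replaceSum k Z p e γ η := by
  classical
  have := Fintype.ofFinite (Appearance e p)
  rw [replaceMap, replaceSum, finsum_eq_sum_of_fintype, finsum_eq_sum_of_fintype, map_sum,
    Finsupp.finsetSum_apply]
  refine Finset.sum_congr rfl fun x _ => ?_
  split_ifs with h
  · rw [coef_ofPath hη, Finsupp.single_apply]
    congr 1
    simp [eq_comm]
  · rw [ofPath_of_notMem h, map_zero, Finsupp.zero_apply]

theorem ofPath_consRight {a b c d m : V} {e : b ⟶ c} {p : Path a m} (e' : m ⟶ d) (γ : Path b c)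
    (x : Appearance e p) :
    ofPath k Z (((Appearance.consRight e' x).1.1.comp γ).comp (Appearance.consRight e' x).1.2)
      = ofPath k Z e'.toPath * ofPath k Z ((x.1.1.comp γ).comp x.1.2) := by
  rw [← ofPath_cons]
  rfl

theorem replaceMap_cons_of_ne {a b c d m : V} (p : Path a m) (e : b ⟶ c) (γ : Path b c)
    (e' : m ⟶ d) (h : (⟨m, d, e'⟩ : Quiver.Total V) ≠ ⟨b, c, e⟩) :
    replaceMap k Z (p.cons e') e γ = ofPath k Z e'.toPath * replaceMap k Z p e γ := by
  have := Fintype.ofFinite (Appearance e p)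
  have := Fintype.ofFinite (Appearance e (p.cons e'))
  rw [replaceMap, replaceMap, finsum_eq_sum_of_fintype, finsum_eq_sum_of_fintype, Finset.mul_sum]
  symm
  refine Fintype.sum_bijective (Appearance.consRight e')
    ⟨Appearance.consRight_injective e', ?_⟩ _ _ fun x => (ofPath_consRight e' γ x).symm
  rintro ⟨⟨l, r⟩, hx⟩
  cases r with
  | nil =>
    exfalso
    refine h ?_
    obtain rfl := Path.obj_eq_of_cons_eq_cons hx
    obtain rfl := eq_of_heq (Path.hom_heq_of_cons_eq_cons hx)
    rfl
  | cons r e'' =>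
    obtain rfl := Path.obj_eq_of_cons_eq_cons hx
    obtain rfl := eq_of_heq (Path.hom_heq_of_cons_eq_cons hx)
    exact ⟨⟨(l, r), eq_of_heq (Path.heq_of_cons_eq_cons hx)⟩, rfl⟩

theorem replaceMap_cons_self {a b c : V} (p : Path a b) (e : b ⟶ c) (γ : Path b c) :
    replaceMap k Z (p.cons e) e γ
      = ofPath k Z e.toPath * replaceMap k Z p e γ + ofPath k Z γ * ofPath k Z p := by
  have := Fintype.ofFinite (Appearance e p)
  have := Fintype.ofFinite (Appearance e (p.cons e))
  rw [replaceMap, replaceMap, finsum_eq_sum_of_fintype, finsum_eq_sum_of_fintype, Finset.mul_sum,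
    add_comm]
  symm
  let x₀ : Appearance e (p.cons e) := ⟨(p, Path.nil), rfl⟩
  let φ : Option (Appearance e p) → Appearance e (p.cons e) :=
    fun x => x.elim x₀ (Appearance.consRight e)
  rw [← Fintype.sum_bijective φ ⟨?_, ?_⟩
    (fun x => ofPath k Z (((φ x).1.1.comp γ).comp (φ x).1.2)) _ (fun _ => rfl),
    Fintype.sum_option, ofPath_mul_ofPath]
  · congr 1
    exact Finset.sum_congr rfl fun x _ => (ofPath_consRight e γ x).symm
  · have hne : ∀ x : Appearance e p, Appearance.consRight e x ≠ x₀ := fun x hx => by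
      have := congrArg (fun y : Appearance e (p.cons e) => y.1.2.length) hx
      simp [Appearance.consRight, x₀] at this
    rintro (_ | x) (_ | y) h
    · rfl
    · exact absurd h.symm (hne y)
    · exact absurd h (hne x)
    · exact congrArg some (Appearance.consRight_injective e h)
  · rintro ⟨⟨l, r⟩, hx⟩
    cases r with
    | nil =>
      obtain rfl := eq_of_heq (Path.heq_of_cons_eq_cons hx)
      exact ⟨none, rfl⟩
    | cons r e'' =>
      obtain rfl := Path.obj_eq_of_cons_eq_cons hx
      obtain rfl := eq_of_heq (Path.hom_heq_of_cons_eq_cons hx)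
      exact ⟨some ⟨(l, r), eq_of_heq (Path.heq_of_cons_eq_cons hx)⟩, rfl⟩

end Derivations

/-! ### Derivations modulo longer paths. -/

section ArrowMatrix

attribute [local instance] LieRing.ofAssociativeRing LieAlgebra.ofAssociativeAlgebra

variable {k : Type w} [Field k] {V : Type u} [Quiver.{v} V] [Fintype V]
  {Z : PathSet V} {f : Module.End k (MonomialAlgebra k Z)}

omit [Fintype V] in
-- Replacing a loop by a vertex shortens a path by one.
theorem replaceSum_nil_apply_eq_zero {a d v : V} (p : Path a d) (e : v ⟶ v) (η : Path a d)
    (h : p.length ≤ η.length) : replaceSum k Z p e Path.nil η = 0 := by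
  classical
  have := Fintype.ofFinite (Appearance e p)
  rw [replaceSum, finsum_eq_sum_of_fintype, Finsupp.finsetSum_apply]
  refine Finset.sum_eq_zero fun x _ => ?_
  split_ifs
  · rw [Finsupp.single_apply, if_neg]
    rintro rfl
    have := congrArg Path.length x.2
    simp only [Path.length_comp, Path.length_cons, Path.length_nil] at this h
    omega
  · rw [Finsupp.zero_apply]

open scoped Classical in
/-- A derivation applied to a path, modulo longer paths. -/
theorem der_sub_sum_replaceMap_mem [∀ a b : V, Fintype (a ⟶ b)]
    (hf : f ∈ hochschildDer k (MonomialAlgebra k Z)) {a d : V} (p : Path a d) :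
    f (ofPath k Z p) - ∑ x : Σ v : V, v ⟶ v,
        coef (Path.nil : Path x.1 x.1) (f (ofPath k Z x.2.toPath))
          • replaceMap k Z p x.2 Path.nil ∈ arrowPow p.length := by
  induction p with
  | nil => exact mem_arrowPow_zero _
  | @cons m d p e ih =>
    let c : (Σ v : V, v ⟶ v) → k := fun x =>
      coef (Path.nil : Path x.1 x.1) (f (ofPath k Z x.2.toPath))
    have hrec : ∀ x : Σ v : V, v ⟶ v, replaceMap k Z (p.cons e) x.2 Path.nil
        = ofPath k Z e.toPath * replaceMap k Z p x.2 Path.nil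
          + (if (⟨m, d, e⟩ : Quiver.Total V) = ⟨x.1, x.1, x.2⟩
            then ofPath k Z (Path.nil : Path x.1 x.1) else 0) * ofPath k Z p := by
      rintro ⟨v, e'⟩
      split_ifs with h
      · cases h
        exact replaceMap_cons_self p e' Path.nil
      · rw [replaceMap_cons_of_ne p e' Path.nil e h, zero_mul, add_zero]
    -- Modulo paths of positive length, `f e` is a multiple of the vertex if `e` is a loop and zero
    -- otherwise.
    have hsub : f (ofPath k Z e.toPath) - ∑ x : Σ v : V, v ⟶ v, c x •
        (if (⟨m, d, e⟩ : Quiver.Total V) = ⟨x.1, x.1, x.2⟩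
            then ofPath k Z (Path.nil : Path x.1 x.1) else 0) ∈ arrowPow 1 := by
      rw [mem_arrowPow_iff]
      intro i j q hq
      obtain rfl := Path.eq_of_length_zero q (by omega)
      rw [Path.eq_nil_of_length_zero q (by omega), map_sub, map_sum]
      by_cases hloop : i = m ∧ i = d
      · obtain ⟨rfl, rfl⟩ := hloop
        by_cases hn : (Path.nil : Path i i) ∈ nonzeroPaths Z i i
        · rw [Finset.sum_eq_single (⟨i, e⟩ : Σ v : V, v ⟶ v), if_pos rfl, map_smul,
            coef_ofPath_self hn, smul_eq_mul, mul_one, sub_self]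
          · rintro ⟨v, e'⟩ _ hne
            rw [if_neg, smul_zero, map_zero]
            intro h
            cases h
            exact hne rfl
          · exact fun h => absurd (Finset.mem_univ _) h
        · simp only [coef_of_notMem hn, Finset.sum_const_zero, sub_self]
      · rw [coef_der_arrow_eq_zero_of_not_parallel hf e _ (by simp) (by tauto), zero_sub,
          neg_eq_zero]
        refine Finset.sum_eq_zero fun x _ => ?_
        split_ifs with h
        · obtain ⟨v, e'⟩ := x
          cases h
          rw [map_smul, coef_ofPath_of_ne, smul_zero]
          exact fun h => hloop ⟨congrArg Sigma.fst h, congrArg Sigma.fst h⟩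
        · rw [smul_zero, map_zero]
    have hsum : f (ofPath k Z (p.cons e)) - ∑ x : Σ v : V, v ⟶ v, c x •
        replaceMap k Z (p.cons e) x.2 Path.nil
        = ofPath k Z e.toPath * (f (ofPath k Z p) - ∑ x : Σ v : V, v ⟶ v, c x •
            replaceMap k Z p x.2 Path.nil)
          + (f (ofPath k Z e.toPath) - ∑ x : Σ v : V, v ⟶ v, c x •
        (if (⟨m, d, e⟩ : Quiver.Total V) = ⟨x.1, x.1, x.2⟩
            then ofPath k Z (Path.nil : Path x.1 x.1) else 0)) * ofPath k Z p := by
      simp only [hrec, smul_add, Finset.sum_add_distrib, ofPath_cons, map_mul_of_mem_der hf,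
        mul_sub, sub_mul, Finset.mul_sum, Finset.sum_mul, mul_smul_comm, smul_mul_assoc]
      abel
    change _ - ∑ x : Σ v : V, v ⟶ v, c x • replaceMap k Z (p.cons e) x.2 Path.nil ∈ _
    rw [hsum, Path.length_cons]
    refine Submodule.add_mem _ ?_ ?_
    · rw [add_comm p.length 1]
      exact mul_mem_arrowPow (ofPath_mem_arrowPow _ le_rfl) ih
    · rw [add_comm p.length 1]
      exact mul_mem_arrowPow hsub (ofPath_mem_arrowPow _ le_rfl)

variable [∀ a b : V, Finite (a ⟶ b)]

/-- For a relation `p`, the element `f p = 0` agrees, modulo paths of length at least `p.length`,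
with the combination of the paths obtained from `p` by deleting a loop. These are shorter than `p`,
so the combination vanishes. The coefficients thus define an element of `L₋₁`, which is zero. -/
theorem coef_nil_der_loop (hZ : IsMinimalRelations Z) (hL : LMinusOne k Z = ⊥)
    (hf : f ∈ hochschildDer k (MonomialAlgebra k Z)) {v : V} (e : v ⟶ v) :
    coef (Path.nil : Path v v) (f (ofPath k Z e.toPath)) = 0 := by
  classical
  have : ∀ a b : V, Fintype (a ⟶ b) := fun a b => Fintype.ofFinite _
  have hnil : ∀ v : V, (Path.nil : Path v v) ∈ nonzeroPaths Z v v := fun v =>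
    mem_nonzeroPaths_of_length hZ (by simp)
  let c : (Σ v : V, v ⟶ v) → k := fun x =>
    coef (Path.nil : Path x.1 x.1) (f (ofPath k Z x.2.toPath))
  let φ : (Σ v : V, v ⟶ v) → ArrowPathPair Z := fun x => ⟨x.2, Path.nil, hnil x.1⟩
  have hφ : Function.Injective φ := by
    rintro ⟨v, e⟩ ⟨v', e'⟩ h
    obtain rfl : v = v' := congrArg ArrowPathPair.src h
    have : (⟨v, v, e⟩ : Quiver.Total V) = ⟨v, v, e'⟩ :=
      congrArg (fun y : ArrowPathPair Z => (⟨y.src, y.tgt, y.arrow⟩ : Quiver.Total V)) h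
    cases this
    rfl
  have hmem : Finsupp.mapDomain φ (Finsupp.equivFunOnFinite.symm c) ∈ LMinusOne k Z := by
    refine ⟨?_, ?_⟩
    · refine fun y hy => ?_
      obtain ⟨x, -, rfl⟩ := Finset.mem_image.1 (Finsupp.mapDomain_support hy)
      rfl
    · rw [SetLike.mem_coe, LinearMap.mem_ker, psiOne, Finsupp.linearCombination_mapDomain,
        Finsupp.linearCombination_apply, Finsupp.sum_fintype _ _ (by simp)]
      funext y
      rw [Finset.sum_apply]
      change ∑ x, c x • replaceSum k Z y.rel x.2 Path.nil y.path = 0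
      by_cases hy : y.rel.length ≤ y.path.length
      · exact Finset.sum_eq_zero fun x _ => by
          rw [replaceSum_nil_apply_eq_zero _ _ _ hy, smul_zero]
      · have h := mem_arrowPow_iff.1 (der_sub_sum_replaceMap_mem hf y.rel) y.path (not_le.1 hy)
        rw [ofPath_of_mem y.rel_mem, map_zero, zero_sub, map_neg, neg_eq_zero, map_sum] at h
        rw [← h]
        exact Finset.sum_congr rfl fun x _ => by
          rw [map_smul, coef_replaceMap _ _ _ _ y.path_mem]
  rw [hL, Submodule.mem_bot] at hmem
  have h0 : Finsupp.equivFunOnFinite.symm c = 0 :=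
    Finsupp.mapDomain_injective hφ (hmem.trans Finsupp.mapDomain_zero.symm)
  exact DFunLike.congr_fun h0 (⟨v, e⟩ : Σ v : V, v ⟶ v)

theorem der_arrow_mem_arrowPow (hZ : IsMinimalRelations Z) (hL : LMinusOne k Z = ⊥)
    (hf : f ∈ hochschildDer k (MonomialAlgebra k Z)) {a b : V} (e : a ⟶ b) :
    f (ofPath k Z e.toPath) ∈ arrowPow 1 := by
  rw [mem_arrowPow_iff]
  intro i j q hq
  obtain rfl := Path.eq_of_length_zero q (by omega)
  rw [Path.eq_nil_of_length_zero q (by omega)]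
  by_cases h : i = a ∧ i = b
  · obtain ⟨rfl, rfl⟩ := h
    exact coef_nil_der_loop hZ hL hf e
  · exact coef_der_arrow_eq_zero_of_not_parallel hf e _ (by simp) (by tauto)

omit [∀ a b : V, Finite (a ⟶ b)] in
/-- A derivation which raises the degree of the vertices and of the arrows by `n` raises the degree
of every element by `n`. -/
theorem der_mem_arrowPow_of_forall (hf : f ∈ hochschildDer k (MonomialAlgebra k Z)) (n : ℕ)
    (h0 : ∀ i : V, f (ofPath k Z (Path.nil : Path i i)) ∈ arrowPow n)
    (h1 : ∀ {a b : V} (e : a ⟶ b), f (ofPath k Z e.toPath) ∈ arrowPow (n + 1))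
    {m : ℕ} {x : MonomialAlgebra k Z} (hx : x ∈ arrowPow m) : f x ∈ arrowPow (n + m) := by
  have hp : ∀ {a b : V} (p : Path a b), f (ofPath k Z p) ∈ arrowPow (n + p.length) := by
    intro a b p
    induction p with
    | nil => exact h0 a
    | cons p e ih =>
      rw [ofPath_cons, map_mul_of_mem_der hf]
      refine Submodule.add_mem _ ?_ ?_
      · have := mul_mem_arrowPow (ofPath_mem_arrowPow (k := k) (Z := Z) e.toPath le_rfl) ih
        exact arrowPow_antitone (by simp; omega) this
      · have := mul_mem_arrowPow (h1 e) (ofPath_mem_arrowPow (k := k) (Z := Z) p le_rfl)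
        exact arrowPow_antitone (by simp; omega) this
  induction hx using Submodule.span_induction with
  | zero => rw [map_zero]; exact Submodule.zero_mem _
  | add x y _ _ hx hy => rw [map_add]; exact Submodule.add_mem _ hx hy
  | smul c x _ hx => rw [map_smul]; exact Submodule.smul_mem _ _ hx
  | mem x hx =>
    obtain ⟨a, b, p, hp', rfl⟩ := hx
    exact arrowPow_antitone (by omega) (hp p)

theorem der_mem_arrowPow (hZ : IsMinimalRelations Z) (hL : LMinusOne k Z = ⊥)
    (hf : f ∈ hochschildDer k (MonomialAlgebra k Z)) {m : ℕ} {x : MonomialAlgebra k Z}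
    (hx : x ∈ arrowPow m) : f x ∈ arrowPow m := by
  have := der_mem_arrowPow_of_forall hf 0 (fun _ => mem_arrowPow_zero _)
    (der_arrow_mem_arrowPow hZ hL hf) hx
  rwa [zero_add] at this

/-! #### The action of a derivation on the arrows -/

instance : Finite (Quiver.Total V) :=
  Finite.of_injective (fun x : Quiver.Total V => (⟨x.left, x.right, x.hom⟩ : Σ a b : V, a ⟶ b)) (by
    rintro ⟨a, b, e⟩ ⟨a', b', e'⟩ h
    cases h
    rfl)

instance : Fintype (Quiver.Total V) := Fintype.ofFinite _

omit [Fintype V] [∀ a b : V, Finite (a ⟶ b)] in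
theorem toPath_mem_nonzeroPaths (hZ : IsMinimalRelations Z) (x : Quiver.Total V) :
    x.hom.toPath ∈ nonzeroPaths Z x.left x.right :=
  mem_nonzeroPaths_of_length hZ (by simp)

omit [Fintype V] [∀ a b : V, Finite (a ⟶ b)] in
theorem total_eq_of_sigma_eq {x y : Quiver.Total V}
    (h : (⟨x.left, x.right, x.hom.toPath⟩ : QuiverPath V) = ⟨y.left, y.right, y.hom.toPath⟩) :
    x = y := by
  obtain ⟨a, b, e⟩ := x
  obtain ⟨a', b', e'⟩ := y
  obtain rfl : a = a' := congrArg Sigma.fst h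
  obtain rfl : b = b' := congrArg (fun η : QuiverPath V => η.2.1) h
  have : e.toPath = e'.toPath := by simpa using h
  rw [toPath_injective this]

omit [∀ a b : V, Finite (a ⟶ b)] in
open scoped Classical in
theorem coef_arrow (hZ : IsMinimalRelations Z) (x y : Quiver.Total V) :
    coef y.hom.toPath (ofPath k Z x.hom.toPath) = if y = x then 1 else 0 := by
  split_ifs with h
  · subst h
    exact coef_ofPath_self (toPath_mem_nonzeroPaths hZ y)
  · exact coef_ofPath_of_ne fun h' => h (total_eq_of_sigma_eq h')

theorem sub_sum_arrows_mem_arrowPow (hZ : IsMinimalRelations Z) {x : MonomialAlgebra k Z}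
    (hx : x ∈ arrowPow 1) :
    x - ∑ y : Quiver.Total V, coef y.hom.toPath x • ofPath k Z y.hom.toPath ∈ arrowPow 2 := by
  classical
  rw [mem_arrowPow_iff]
  intro a b p hp
  rw [map_sub, map_sum]
  by_cases h0 : p.length = 0
  · rw [mem_arrowPow_iff.1 hx p (by omega), zero_sub, neg_eq_zero]
    refine Finset.sum_eq_zero fun y _ => ?_
    rw [map_smul, coef_ofPath_of_ne, smul_zero]
    intro h
    have := congrArg (fun η : QuiverPath V => η.2.2.length) h
    simp [h0] at this
  · obtain ⟨c, e, q, hq, rfl⟩ := Path.eq_toPath_comp_of_length_eq_succ p (n := 0) (by omega)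
    obtain rfl := Path.eq_of_length_zero q hq
    rw [Path.eq_nil_of_length_zero q hq, Path.comp_nil]
    change coef (⟨a, c, e⟩ : Quiver.Total V).hom.toPath x
      - ∑ y : Quiver.Total V, coef (⟨a, c, e⟩ : Quiver.Total V).hom.toPath _ = 0
    rw [Finset.sum_eq_single (⟨a, c, e⟩ : Quiver.Total V), map_smul, coef_arrow hZ, if_pos rfl,
      smul_eq_mul, mul_one, sub_self]
    · intro y _ hy
      rw [map_smul, coef_arrow hZ, if_neg hy.symm, smul_zero]
    · exact fun h => absurd (Finset.mem_univ _) h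

variable (f) in
/-- The matrix of the action of a linear endomorphism on the arrows. -/
def arrowMatrix : Matrix (Quiver.Total V) (Quiver.Total V) k := fun y x =>
  coef y.hom.toPath (f (ofPath k Z x.hom.toPath))

/-- The derivation `f` preserves `arrowPow 2`, so only the arrow part of `g x` affects the arrow
coefficients of `f (g x)`. The product `f * g` need not be a derivation; its matrix makes sense
regardless. -/
theorem arrowMatrix_mul (hZ : IsMinimalRelations Z) (hL : LMinusOne k Z = ⊥)
    {g : Module.End k (MonomialAlgebra k Z)}
    (hf : f ∈ hochschildDer k (MonomialAlgebra k Z))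
    (hg : g ∈ hochschildDer k (MonomialAlgebra k Z)) :
    arrowMatrix (f * g) = arrowMatrix f * arrowMatrix g := by
  ext y x
  rw [Matrix.mul_apply]
  have h := mem_arrowPow_iff.1 (der_mem_arrowPow hZ hL hf (sub_sum_arrows_mem_arrowPow hZ
    (der_arrow_mem_arrowPow hZ hL hg x.hom))) y.hom.toPath (by simp)
  rw [map_sub, map_sub, sub_eq_zero, map_sum, map_sum] at h
  refine h.trans (Finset.sum_congr rfl fun z _ => ?_)
  rw [map_smul, map_smul, smul_eq_mul, mul_comm]
  rfl

open scoped Classical in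
/-- The Lie algebra homomorphism given by the action of the derivations on the arrows, modulo paths
of length at least two. -/
def arrowHom (hZ : IsMinimalRelations Z) (hL : LMinusOne k Z = ⊥) :
    hochschildDer k (MonomialAlgebra k Z) →ₗ⁅k⁆ Matrix (Quiver.Total V) (Quiver.Total V) k where
  toFun D := arrowMatrix (D : Module.End k (MonomialAlgebra k Z))
  map_add' D D' := by
    ext y x
    exact map_add (coef (k := k) (Z := Z) y.hom.toPath) _ _
  map_smul' c D := by
    ext y x
    exact map_smul (coef (k := k) (Z := Z) y.hom.toPath) c _
  map_lie' {D D'} := by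
    rw [LieRing.of_associative_ring_bracket, ← arrowMatrix_mul hZ hL D.2 D'.2,
      ← arrowMatrix_mul hZ hL D'.2 D.2]
    ext y x
    exact map_sub (coef (k := k) (Z := Z) y.hom.toPath) _ _

end ArrowMatrix

/-! #### Existence of derivations -/

section Existence

attribute [local instance] LieRing.ofAssociativeRing LieAlgebra.ofAssociativeAlgebra

variable {k : Type w} [Field k] {V : Type u} [Quiver.{v} V] [Fintype V] {Z : PathSet V}

/-- The extension by the Leibniz rule of a function on the arrows to the paths. -/
def leibnizExtend (δ : ∀ {a b : V}, (a ⟶ b) → MonomialAlgebra k Z) {a : V} :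
    ∀ {b : V}, Path a b → MonomialAlgebra k Z
  | _, Path.nil => 0
  | _, Path.cons p e => ofPath k Z e.toPath * leibnizExtend δ p + δ e * ofPath k Z p

variable {δ : ∀ {a b : V}, (a ⟶ b) → MonomialAlgebra k Z}

theorem ofPath_nil_mul {a b : V} (p : Path a b) :
    ofPath k Z (Path.nil : Path b b) * ofPath k Z p = ofPath k Z p := by
  rw [ofPath_mul_ofPath, Path.comp_nil]

theorem ofPath_mul_nil {a b : V} (p : Path a b) :
    ofPath k Z p * ofPath k Z (Path.nil : Path a a) = ofPath k Z p := by
  rw [ofPath_mul_ofPath, Path.nil_comp]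

theorem nil_mul_leibnizExtend
    (hl : ∀ {a b : V} (e : a ⟶ b), ofPath k Z (Path.nil : Path b b) * δ e = δ e)
    {a b : V} (p : Path a b) :
    ofPath k Z (Path.nil : Path b b) * leibnizExtend δ p = leibnizExtend δ p := by
  cases p with
  | nil => rw [leibnizExtend, mul_zero]
  | cons p e => rw [leibnizExtend, mul_add, ← mul_assoc, ← mul_assoc, ofPath_nil_mul, hl]

theorem leibnizExtend_mul_nil
    {a b : V} (p : Path a b) :
    leibnizExtend δ p * ofPath k Z (Path.nil : Path a a) = leibnizExtend δ p := by
  induction p with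
  | nil => rw [leibnizExtend, zero_mul]
  | cons p e ih => rw [leibnizExtend, add_mul, mul_assoc, mul_assoc, ofPath_mul_nil, ih]

theorem leibnizExtend_comp
    (hl : ∀ {a b : V} (e : a ⟶ b), ofPath k Z (Path.nil : Path b b) * δ e = δ e)
    {a b c : V} (α : Path a b) (β : Path b c) :
    leibnizExtend δ (α.comp β)
      = ofPath k Z β * leibnizExtend δ α + leibnizExtend δ β * ofPath k Z α := by
  induction β with
  | nil => rw [Path.comp_nil, leibnizExtend, zero_mul, add_zero, nil_mul_leibnizExtend hl]
  | cons β e ih =>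
    rw [Path.comp_cons, leibnizExtend, leibnizExtend, ih, ofPath_cons, ← ofPath_mul_ofPath]
    simp only [mul_add, add_mul, mul_assoc, add_assoc]

/-- The suffix `r` is carried along so that the induction can peel off the last arrow of `p` and
move it into `r`. -/
theorem mul_leibnizExtend_eq_zero {a b d : V} (p : Path a b) (r : Path b d)
    (h : ∀ {m n : V} (l : Path a m) (e : m ⟶ n) (r' : Path n b), (l.cons e).comp r' = p →
      ofPath k Z (r'.comp r) * δ e * ofPath k Z l = 0) :
    ofPath k Z r * leibnizExtend δ p = 0 := by
  induction p with
  | nil => rw [leibnizExtend, mul_zero]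
  | cons p e ih =>
    rw [leibnizExtend, mul_add, ← mul_assoc, ofPath_mul_ofPath, ih, zero_add, ← mul_assoc]
    · simpa using h p e Path.nil rfl
    · intro m n l e' r' hp
      rw [← Path.comp_assoc, Path.comp_toPath_eq_cons]
      exact h l e' (r'.cons e) (by rw [Path.comp_cons, hp])

/-- The Leibniz extension is a derivation from `kQ` to `Λ` along the projection. Only its vanishing
on the relations is needed for it to descend, and `hδ` makes each Leibniz term of a relation vanish
separately. -/
theorem exists_der
    (hl : ∀ {a b : V} (e : a ⟶ b), ofPath k Z (Path.nil : Path b b) * δ e = δ e)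
    (hr : ∀ {a b : V} (e : a ⟶ b), δ e * ofPath k Z (Path.nil : Path a a) = δ e)
    (hδ : ∀ {a b c d : V} (l : Path a b) (e : b ⟶ c) (r : Path c d),
      (l.comp e.toPath).comp r ∈ Z a d → ofPath k Z r * δ e * ofPath k Z l = 0) :
    ∃ f ∈ hochschildDer k (MonomialAlgebra k Z),
      (∀ i : V, f (ofPath k Z (Path.nil : Path i i)) = 0) ∧
      ∀ {a b : V} (e : a ⟶ b), f (ofPath k Z e.toPath) = δ e := by
  let F : PathAlgebra k V →ₗ[k] MonomialAlgebra k Z :=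
    (Finsupp.linearCombination k fun η : QuiverPath V => leibnizExtend δ η.2.2 :
      (QuiverPath V →₀ k) →ₗ[k] MonomialAlgebra k Z)
  have hF : ∀ {a b : V} (p : Path a b), F (PathAlgebra.of k p) = leibnizExtend δ p := fun p =>
    (Finsupp.linearCombination_single k (1 : k) _).trans (one_smul _ _)
  have hmul : ∀ x y, F (x * y) = proj k Z x * F y + F x * proj k Z y := by
    intro x y
    induction x using PathAlgebra.induction_on with
    | h0 => simp only [zero_mul, map_zero, add_zero]
    | hadd x x' hx hx' =>
      rw [add_mul, map_add, hx, hx', map_add, map_add, add_mul, add_mul]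
      abel
    | @hof s a b p =>
      induction y using PathAlgebra.induction_on with
      | h0 => simp only [mul_zero, map_zero, add_zero]
      | hadd x x' hx hx' =>
        rw [mul_add, map_add, hx, hx', map_add, map_add, mul_add, mul_add]
        abel
      | @hof t c d q =>
        simp only [smul_mul_assoc, mul_smul_comm, map_smul, ← smul_add, hF]
        change _ = t • s • (ofPath k Z p * leibnizExtend δ q + leibnizExtend δ p * ofPath k Z q)
        congr 2
        by_cases h : d = a
        · subst h
          rw [PathAlgebra.of_mul_of_comp, hF, leibnizExtend_comp hl]
        · rw [PathAlgebra.of_mul_of_ne _ _ h, map_zero, ← nil_mul_leibnizExtend hl q,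
            ← leibnizExtend_mul_nil p, ← mul_assoc, mul_assoc (leibnizExtend δ p),
            ofPath_mul_ofPath_of_ne _ _ h, ofPath_mul_ofPath_of_ne _ _ h, zero_mul, mul_zero,
            add_zero]
  -- The kernel of `F` alone need not be an ideal; its intersection with the kernel of the
  -- projection is one, by the Leibniz rule.
  let I : TwoSidedIdeal (PathAlgebra k V) :=
    TwoSidedIdeal.mk' {x | proj k Z x = 0 ∧ F x = 0} ⟨map_zero _, map_zero _⟩
      (fun {x y} hx hy => ⟨by rw [map_add, hx.1, hy.1, add_zero],
        by rw [map_add, hx.2, hy.2, add_zero]⟩)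
      (fun {x} hx => ⟨by rw [map_neg, hx.1, neg_zero], by rw [map_neg, hx.2, neg_zero]⟩)
      (fun {x y} hy => ⟨by rw [map_mul, hy.1, mul_zero],
        by rw [hmul, hy.1, hy.2, mul_zero, mul_zero, add_zero]⟩)
      (fun {x y} hx => ⟨by rw [map_mul, hx.1, zero_mul],
        by rw [hmul, hx.1, hx.2, zero_mul, zero_mul, add_zero]⟩)
  have hI : relationIdeal k Z ≤ I := by
    refine TwoSidedIdeal.span_le.2 ?_
    rintro _ ⟨a, b, p, hp, rfl⟩
    refine (TwoSidedIdeal.mem_mk' ..).2 ⟨ofPath_of_mem hp, ?_⟩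
    rw [hF, ← nil_mul_leibnizExtend hl]
    refine mul_leibnizExtend_eq_zero p Path.nil fun l e r h => ?_
    rw [Path.comp_nil]
    exact hδ l e r (by rwa [Path.comp_toPath_eq_cons, h])
  obtain ⟨g, hg⟩ := exists_descend F fun x hx => ((TwoSidedIdeal.mem_mk' ..).1 (hI hx)).2
  have hg' : ∀ {a b : V} (p : Path a b), g (ofPath k Z p) = leibnizExtend δ p := fun p =>
    (hg _).trans (hF p)
  refine ⟨g, ?_, fun i => by rw [hg', leibnizExtend], fun {a b} e => ?_⟩
  · intro x y
    obtain ⟨x, rfl⟩ := proj_surjective k Z x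
    obtain ⟨y, rfl⟩ := proj_surjective k Z y
    rw [← map_mul, hg, hg, hg, hmul]
  · rw [hg', Quiver.Hom.toPath, leibnizExtend, leibnizExtend, mul_zero, zero_add, hr]

variable [∀ a b : V, Finite (a ⟶ b)]

/-- A matrix which replaces arrows by parallel arrows, without replacing a relation by a nonzero
path, is the matrix of a derivation. -/
theorem exists_der_of_matrix (N : Matrix (Quiver.Total V) (Quiver.Total V) k)
    (hN : ∀ y x, N y x ≠ 0 → x.left = y.left ∧ x.right = y.right)
    (hN' : ∀ {a b c d : V} (l : Path a b) (e e' : b ⟶ c) (r : Path c d),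
      (l.comp e.toPath).comp r ∈ Z a d → N ⟨b, c, e'⟩ ⟨b, c, e⟩ ≠ 0 →
        (l.comp e'.toPath).comp r ∉ nonzeroPaths Z a d) :
    ∃ f ∈ hochschildDer k (MonomialAlgebra k Z),
      (∀ i : V, f (ofPath k Z (Path.nil : Path i i)) = 0) ∧
      ∀ x : Quiver.Total V, f (ofPath k Z x.hom.toPath)
        = ∑ y : Quiver.Total V, N y x • ofPath k Z y.hom.toPath := by
  let δ : ∀ {a b : V}, (a ⟶ b) → MonomialAlgebra k Z := fun {a b} e =>
    ∑ y : Quiver.Total V, N y ⟨a, b, e⟩ • ofPath k Z y.hom.toPath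
  suffices h : ∃ f ∈ hochschildDer k (MonomialAlgebra k Z),
      (∀ i : V, f (ofPath k Z (Path.nil : Path i i)) = 0) ∧
      ∀ {a b : V} (e : a ⟶ b), f (ofPath k Z e.toPath) = δ e by
    obtain ⟨f, hf, hf0, hf1⟩ := h
    exact ⟨f, hf, hf0, fun x => hf1 x.hom⟩
  refine exists_der ?_ ?_ ?_
  · intro a b e
    rw [Finset.mul_sum]
    refine Finset.sum_congr rfl fun y _ => ?_
    by_cases h : N y ⟨a, b, e⟩ = 0
    · rw [h, zero_smul, mul_zero]
    · obtain ⟨c, d, e'⟩ := y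
      obtain ⟨rfl, rfl⟩ := hN _ _ h
      rw [mul_smul_comm, ofPath_nil_mul]
  · intro a b e
    rw [Finset.sum_mul]
    refine Finset.sum_congr rfl fun y _ => ?_
    by_cases h : N y ⟨a, b, e⟩ = 0
    · rw [h, zero_smul, zero_mul]
    · obtain ⟨c, d, e'⟩ := y
      obtain ⟨rfl, rfl⟩ := hN _ _ h
      rw [smul_mul_assoc, ofPath_mul_nil]
  · intro a b c d l e r hp
    rw [Finset.mul_sum, Finset.sum_mul]
    refine Finset.sum_eq_zero fun y _ => ?_
    by_cases h : N y ⟨b, c, e⟩ = 0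
    · rw [h, zero_smul, mul_zero, zero_mul]
    · obtain ⟨b', c', e'⟩ := y
      obtain ⟨h1, h2⟩ := hN _ _ h
      change b = b' at h1
      change c = c' at h2
      subst h1 h2
      rw [mul_smul_comm, smul_mul_assoc, ofPath_mul_ofPath, ofPath_mul_ofPath, ← Path.comp_assoc,
        ofPath_of_notMem (hN' l e e' r hp h), smul_zero]

theorem arrowMatrix_eq_of_forall (hZ : IsMinimalRelations Z)
    {f : Module.End k (MonomialAlgebra k Z)} {N : Matrix (Quiver.Total V) (Quiver.Total V) k}
    (hf : ∀ x : Quiver.Total V, f (ofPath k Z x.hom.toPath)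
        = ∑ y : Quiver.Total V, N y x • ofPath k Z y.hom.toPath) : arrowMatrix f = N := by
  classical
  ext y x
  rw [arrowMatrix, hf, map_sum, Finset.sum_eq_single y]
  · rw [map_smul, coef_arrow hZ, if_pos rfl, smul_eq_mul, mul_one]
  · intro z _ hz
    rw [map_smul, coef_arrow hZ, if_neg hz.symm, smul_zero]
  · exact fun h => absurd (Finset.mem_univ _) h

omit [∀ a b : V, Finite (a ⟶ b)] in
theorem arrowMatrix_apply_ne_zero {f : Module.End k (MonomialAlgebra k Z)}
    (hf : f ∈ hochschildDer k (MonomialAlgebra k Z)) {y x : Quiver.Total V}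
    (h : arrowMatrix f y x ≠ 0) : x.left = y.left ∧ x.right = y.right := by
  by_contra h'
  refine h (coef_der_arrow_eq_zero_of_not_parallel hf x.hom y.hom.toPath (by simp) ?_)
  by_contra h''
  push Not at h''
  exact h' ⟨h''.1.symm, h''.2.symm⟩

open scoped Classical in
theorem matrixUnitLE_of_forall (hZ : IsMinimalRelations Z) (hL : LMinusOne k Z = ⊥)
    {x y : Quiver.Total V} (hxy : x.left = y.left ∧ x.right = y.right)
    (h : ∀ {a b c d : V} (l : Path a b) (e e' : b ⟶ c) (r : Path c d),
      x = ⟨b, c, e⟩ → y = ⟨b, c, e'⟩ → (l.comp e.toPath).comp r ∈ Z a d →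
        (l.comp e'.toPath).comp r ∉ nonzeroPaths Z a d) :
    MatrixUnitLE (arrowHom hZ hL) x y := by
  have hs : ∀ {y' x' : Quiver.Total V}, Matrix.single y x (1 : k) y' x' ≠ 0 → y = y' ∧ x = x' :=
    fun h' => (ite_ne_right_iff.1 ((Matrix.single_apply ..).symm.trans_ne h')).1
  obtain ⟨f, hf, -, hf1⟩ := exists_der_of_matrix (Z := Z) (Matrix.single y x (1 : k))
    (fun y' x' h' => by
      obtain ⟨rfl, rfl⟩ := hs h'
      exact hxy)
    (fun l e e' r hp h' => h l e e' r (hs h').2 (hs h').1 hp)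
  exact ⟨⟨f, hf⟩, arrowMatrix_eq_of_forall hZ hf1⟩

open scoped Classical in
-- One nonzero entry rules out every relation that the replacement would turn into a nonzero path,
-- and this is the condition for the matrix unit to lift. Hence the image of `arrowHom` is spanned
-- by matrix units.
theorem matrixUnitLE_of_apply_ne_zero (hZ : IsMinimalRelations Z) (hL : LMinusOne k Z = ⊥)
    (D : hochschildDer k (MonomialAlgebra k Z)) (x y : Quiver.Total V)
    (h : arrowHom hZ hL D y x ≠ 0) : MatrixUnitLE (arrowHom hZ hL) x y := by
  change arrowMatrix (D : Module.End k (MonomialAlgebra k Z)) y x ≠ 0 at h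
  refine matrixUnitLE_of_forall hZ hL (arrowMatrix_apply_ne_zero D.2 h) ?_
  rintro a b c d l e e' r rfl rfl hp hp'
  by_cases he : e' = e
  · subst he
    exact notMem_nonzeroPaths hp hp'
  · exact h (coef_der_arrow_eq_zero_of_mem D.2 l e e' r he hp hp')

open scoped Classical in
theorem matrixUnitLE_refl (hZ : IsMinimalRelations Z) (hL : LMinusOne k Z = ⊥)
    (x : Quiver.Total V) : MatrixUnitLE (arrowHom hZ hL) x x := by
  refine matrixUnitLE_of_forall hZ hL ⟨rfl, rfl⟩ ?_
  rintro a b c d l e e' r rfl h hp hp'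
  cases h
  exact notMem_nonzeroPaths hp hp'

open scoped Classical in
theorem isCompletelySaturated_of_matrixUnitLE (hZ : IsMinimalRelations Z)
    (hL : LMinusOne k Z = ⊥)
    (h : ∀ x y : Quiver.Total V, x.left = y.left → x.right = y.right →
      MatrixUnitLE (arrowHom hZ hL) x y) : IsCompletelySaturated k Z := by
  intro b c e' e a d p hp
  rw [replaceSum]
  refine finsum_eq_zero_of_forall_eq_zero fun x => if_neg fun hp' => ?_
  obtain ⟨⟨l, r⟩, rfl⟩ := x
  by_cases he : e' = e
  · subst he
    exact notMem_nonzeroPaths hp hp'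
  · obtain ⟨D, hD⟩ := h ⟨b, c, e⟩ ⟨b, c, e'⟩ rfl rfl
    have h0 : arrowHom hZ hL D ⟨b, c, e'⟩ ⟨b, c, e⟩ = 0 :=
      coef_der_arrow_eq_zero_of_mem D.2 l e e' r he hp hp'
    rw [hD, Matrix.single_apply_same] at h0
    exact one_ne_zero h0

omit [Fintype V] [∀ a b : V, Finite (a ⟶ b)] in
-- At the last place where two distinct appearances differ, one new path has `e'` and the other
-- still has `e`. So the terms of `p^(e,e')` are distinct paths and cannot cancel in any
-- characteristic.
theorem appearance_ext_of_replace_eq {a b c d : V} {e e' : b ⟶ c} (he : e ≠ e') {l l' : Path a b}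
    {r r' : Path c d} (h : (l.cons e).comp r = (l'.cons e).comp r')
    (h' : (l.cons e').comp r = (l'.cons e').comp r') : l = l' ∧ r = r' := by
  induction r with
  | nil =>
    cases r' with
    | nil => exact ⟨eq_of_heq (Path.heq_of_cons_eq_cons h), rfl⟩
    | cons r' g =>
      obtain rfl := Path.obj_eq_of_cons_eq_cons h
      have h1 := eq_of_heq (Path.hom_heq_of_cons_eq_cons h)
      have h2 := eq_of_heq (Path.hom_heq_of_cons_eq_cons h')
      exact absurd (h1.trans h2.symm) he
  | cons r g ih =>
    cases r' with
    | nil =>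
      obtain rfl := Path.obj_eq_of_cons_eq_cons h
      have h1 := eq_of_heq (Path.hom_heq_of_cons_eq_cons h)
      have h2 := eq_of_heq (Path.hom_heq_of_cons_eq_cons h')
      exact absurd (h1.symm.trans h2) he
    | cons r' g' =>
      obtain rfl := Path.obj_eq_of_cons_eq_cons h
      obtain rfl := eq_of_heq (Path.hom_heq_of_cons_eq_cons h)
      obtain ⟨rfl, rfl⟩ := ih (eq_of_heq (Path.heq_of_cons_eq_cons h))
        (eq_of_heq (Path.heq_of_cons_eq_cons h'))
      exact ⟨rfl, rfl⟩

omit [Fintype V] [∀ a b : V, Finite (a ⟶ b)] in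
theorem IsCompletelySaturated.notMem_nonzeroPaths (h : IsCompletelySaturated k Z)
    {a b c d : V} (l : Path a b) (e e' : b ⟶ c) (r : Path c d)
    (hp : (l.comp e.toPath).comp r ∈ Z a d) :
    (l.comp e'.toPath).comp r ∉ nonzeroPaths Z a d := by
  classical
  by_cases he : e = e'
  · subst he
    exact _root_.notMem_nonzeroPaths hp
  intro hp'
  have h0 := DFunLike.congr_fun (h b c e' e a d _ hp) ((l.comp e'.toPath).comp r)
  have := Fintype.ofFinite (Appearance e ((l.comp e.toPath).comp r))
  rw [replaceSum, finsum_eq_sum_of_fintype, Finsupp.finsetSum_apply,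
    Finset.sum_eq_single ⟨(l, r), rfl⟩] at h0
  · rw [if_pos hp', Finsupp.single_eq_same, Finsupp.zero_apply] at h0
    exact one_ne_zero h0
  · rintro ⟨⟨l', r'⟩, hx⟩ _ hne
    split_ifs
    · rw [Finsupp.single_apply, if_neg]
      intro hx'
      obtain ⟨rfl, rfl⟩ := appearance_ext_of_replace_eq he hx hx'
      exact hne rfl
    · rfl
  · exact fun h => absurd (Finset.mem_univ _) h

end Existence

/-! #### Inner derivations and the radical -/

section Inner

attribute [local instance] LieRing.ofAssociativeRing LieAlgebra.ofAssociativeAlgebra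

variable {k : Type w} [Field k] {V : Type u} [Quiver.{v} V] [Fintype V] {Z : PathSet V}

theorem mem_innerDer_iff {D : hochschildDer k (MonomialAlgebra k Z)} :
    D ∈ innerDer k (MonomialAlgebra k Z) ↔
      ∃ a, ∀ x, (D : Module.End k (MonomialAlgebra k Z)) x = a * x - x * a := Iff.rfl

/-- The inner derivations act on the arrows by the differences of a function on the vertices. -/
theorem exists_arrowMatrix_eq_of_mem_innerDer (hZ : IsMinimalRelations Z)
    {D : hochschildDer k (MonomialAlgebra k Z)} (hD : D ∈ innerDer k (MonomialAlgebra k Z)) :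
    ∃ φ : V → k, (∀ x y : Quiver.Total V, y ≠ x →
        arrowMatrix (D : Module.End k (MonomialAlgebra k Z)) y x = 0) ∧
      ∀ x : Quiver.Total V, arrowMatrix (D : Module.End k (MonomialAlgebra k Z)) x x
        = φ x.right - φ x.left := by
  obtain ⟨a, ha⟩ := mem_innerDer_iff.1 hD
  refine ⟨fun i => coef (Path.nil : Path i i) a, fun x y hxy => ?_, fun x => ?_⟩
  · rw [arrowMatrix, ha, map_sub, coef_mul_eq_zero_of_forall, coef_mul_eq_zero_of_forall',
      sub_zero]
    · intro e γ h
      have h2 := congrArg (fun η : QuiverPath V => η.2.2.length) h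
      simp only [Path.length_comp, Quiver.Path.length_toPath] at h2
      obtain rfl := Path.eq_of_length_zero γ (by omega)
      rw [Path.eq_nil_of_length_zero γ (by omega), Path.comp_nil] at h
      exact hxy (total_eq_of_sigma_eq h)
    · intro e γ h
      have h2 := congrArg (fun η : QuiverPath V => η.2.2.length) h
      simp only [Path.length_comp, Quiver.Path.length_toPath] at h2
      obtain rfl := Path.eq_of_length_zero γ (by omega)
      rw [Path.eq_nil_of_length_zero γ (by omega), Path.nil_comp] at h
      exact hxy (total_eq_of_sigma_eq h)
  · have hx := toPath_mem_nonzeroPaths hZ x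
    rw [arrowMatrix, ha, map_sub]
    have h1 := coef_comp_mul_right (l := x.hom.toPath) (p := Path.nil) hx a
    have h2 := coef_comp_mul (p := Path.nil) (r := x.hom.toPath) (by rwa [Path.nil_comp]) a
    rw [Path.comp_nil] at h1
    rw [Path.nil_comp] at h2
    rw [h1, h2]

/-- Every derivation is the sum of an inner derivation and of one which vanishes on the
vertices. -/
theorem exists_inner_sub_vertex {f : Module.End k (MonomialAlgebra k Z)}
    (hf : f ∈ hochschildDer k (MonomialAlgebra k Z)) :
    ∃ a, ∀ i : V, f (ofPath k Z (Path.nil : Path i i))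
      = a * ofPath k Z (Path.nil : Path i i) - ofPath k Z (Path.nil : Path i i) * a := by
  classical
  have horth : ∀ i j : V, i ≠ j →
      ofPath k Z (Path.nil : Path i i) * ofPath k Z (Path.nil : Path j j) = 0 := fun i j h =>
    ofPath_mul_ofPath_of_ne _ _ h.symm
  have hidem : ∀ i : V, ofPath k Z (Path.nil : Path i i) * ofPath k Z (Path.nil : Path i i)
      = ofPath k Z (Path.nil : Path i i) := fun i => ofPath_nil_mul _
  -- For `a = ∑ f(e_j) e_j` one has `a e_i = f(e_i) e_i`. Differentiating `e_i e_j = 0` gives `e_i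
  -- f(e_j) e_j = -f(e_i) e_j` for `j ≠ i`, and the term `j = i` is zero. Summing yields `e_i a =
  -- f(e_i) e_i - f(e_i)`.
  refine ⟨∑ j : V, f (ofPath k Z (Path.nil : Path j j)) * ofPath k Z (Path.nil : Path j j),
    fun i => ?_⟩
  have hleft : (∑ j : V, f (ofPath k Z (Path.nil : Path j j)) * ofPath k Z (Path.nil : Path j j))
      * ofPath k Z (Path.nil : Path i i)
      = f (ofPath k Z (Path.nil : Path i i)) * ofPath k Z (Path.nil : Path i i) := by
    rw [Finset.sum_mul, Finset.sum_eq_single i]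
    · rw [mul_assoc, hidem]
    · intro j _ hj
      rw [mul_assoc, horth _ _ hj, mul_zero]
    · exact fun h => absurd (Finset.mem_univ _) h
  have hright : ∀ j : V, ofPath k Z (Path.nil : Path i i)
      * (f (ofPath k Z (Path.nil : Path j j)) * ofPath k Z (Path.nil : Path j j))
      = (if j = i then f (ofPath k Z (Path.nil : Path i i)) * ofPath k Z (Path.nil : Path i i)
          else 0) - f (ofPath k Z (Path.nil : Path i i)) * ofPath k Z (Path.nil : Path j j) := by
    intro j
    obtain rfl | hij := eq_or_ne j i
    · have h := congrArg (ofPath k Z (Path.nil : Path j j) * ·) (map_mul_of_mem_der hf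
        (ofPath k Z (Path.nil : Path j j)) (ofPath k Z (Path.nil : Path j j)))
      simp only [mul_add, ← mul_assoc, hidem] at h
      rw [if_pos rfl, sub_self, ← mul_assoc]
      exact left_eq_add.1 h
    · have h := congrArg (· * ofPath k Z (Path.nil : Path j j)) (map_mul_of_mem_der hf
        (ofPath k Z (Path.nil : Path i i)) (ofPath k Z (Path.nil : Path j j)))
      simp only [horth _ _ hij.symm, map_zero, zero_mul, add_mul, mul_assoc, hidem] at h
      rw [if_neg hij, zero_sub]
      exact eq_neg_of_add_eq_zero_left h.symm
  rw [hleft, Finset.mul_sum, Finset.sum_congr rfl fun j _ => hright j, Finset.sum_sub_distrib,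
    ← Finset.mul_sum, ← one_eq_sum, mul_one, Finset.sum_ite_eq' Finset.univ i,
    if_pos (Finset.mem_univ _), sub_sub_cancel]

section Radical

variable [∀ a b : V, Finite (a ⟶ b)] [FiniteDimensional k (MonomialAlgebra k Z)]

/-- If the radical of the first Hochschild cohomology is zero, then the derivations which act
trivially on the arrows, modulo paths of length at least two, are inner. -/
theorem mem_innerDer_of_arrowHom_eq_zero (hZ : IsMinimalRelations Z) (hL : LMinusOne k Z = ⊥)
    (hrad : LieAlgebra.radical k (HH1 k (MonomialAlgebra k Z)) = ⊥)
    (D : hochschildDer k (MonomialAlgebra k Z)) (hD : arrowHom hZ hL D = 0) :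
    D ∈ innerDer k (MonomialAlgebra k Z) := by
  -- `F n` consists of the derivations raising length by `n`; it is an ideal because no derivation
  -- lowers length.
  let F : ℕ → LieIdeal k (hochschildDer k (MonomialAlgebra k Z)) := fun n =>
    { carrier := {D | ∀ m, ∀ x ∈ (arrowPow m : Submodule k (MonomialAlgebra k Z)),
        (D : Module.End k (MonomialAlgebra k Z)) x ∈ arrowPow (n + m)}
      add_mem' := fun ha hb m x hx => Submodule.add_mem _ (ha m x hx) (hb m x hx)
      zero_mem' := fun m x _ => Submodule.zero_mem _
      smul_mem' := fun c _ ha m x hx => Submodule.smul_mem _ c (ha m x hx)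
      lie_mem := fun {D' D} hD m x hx => Submodule.sub_mem _
        (der_mem_arrowPow hZ hL D'.2 (hD m x hx))
        (hD m _ (der_mem_arrowPow hZ hL D'.2 hx)) }
  obtain ⟨N, hN⟩ := exists_arrowPow_eq_bot (k := k) (Z := Z)
  -- Descending induction on `n`, starting from `F n = 0` for `n ≥ N`. Brackets in `F n` raise
  -- length by `2n`, which is at least `n + 1` because `n ≥ 1`.
  have hF : ∀ j n, N ≤ n + j → 1 ≤ n → F n ≤ innerDer k (MonomialAlgebra k Z) := by
    intro j
    induction j with
    | zero =>
      intro n hn _ D hD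
      have h0 : D = 0 := by
        refine Subtype.ext (LinearMap.ext fun x => ?_)
        exact hN _ (arrowPow_antitone (by omega) (hD 0 x (mem_arrowPow_zero x)))
      rw [h0]
      exact LieSubmodule.zero_mem _
    | succ j ih =>
      intro n hn hn1
      refine LieIdeal.le_of_lie_mem_of_radical_quotient_eq_bot hrad (F n)
        fun D hD D' hD' => ih (n + 1) (by omega) (by omega) fun m x hx => ?_
      refine Submodule.sub_mem _ ?_ ?_
      · exact arrowPow_antitone (by omega) (hD _ _ (hD' m x hx))
      · exact arrowPow_antitone (by omega) (hD' _ _ (hD m x hx))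
  refine hF N 1 (by omega) le_rfl fun m x hx => ?_
  refine der_mem_arrowPow_of_forall D.2 1 (der_vertex_mem_arrowPow D.2) (fun {a b} e => ?_) hx
  have h1 := sub_sum_arrows_mem_arrowPow hZ (der_arrow_mem_arrowPow hZ hL D.2 e)
  rwa [Finset.sum_eq_zero, sub_zero] at h1
  intro y _
  have : coef y.hom.toPath ((D : Module.End k (MonomialAlgebra k Z)) (ofPath k Z e.toPath)) = 0 :=
    congrFun (congrFun hD y) ⟨a, b, e⟩
  rw [this, zero_smul]

/-- If the radical of the first Hochschild cohomology is zero, then every class of parallel arrows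
is a level set of the coboundary of a function on the vertices, and parallel arrows can be replaced
by each other. -/
theorem exists_potential_and_isCompletelySaturated (hZ : IsMinimalRelations Z)
    (hL : LMinusOne k Z = ⊥) (hrad : LieAlgebra.radical k (HH1 k (MonomialAlgebra k Z)) = ⊥) :
    (∀ x : Quiver.Total V, ∃ φ : V → k, φ x.right - φ x.left = 1 ∧
      ∀ y : Quiver.Total V, ¬ (x.left = y.left ∧ x.right = y.right) →
        φ y.right - φ y.left = 0) ∧ IsCompletelySaturated k Z := by
  classical
  have hker := mem_innerDer_of_arrowHom_eq_zero hZ hL hrad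
  have hE := matrixUnitLE_refl (Z := Z) (k := k) hZ hL
  have hext := matrixUnitLE_of_apply_ne_zero (Z := Z) (k := k) hZ hL
  have hsymm : ∀ x y : Quiver.Total V, MatrixUnitLE (arrowHom hZ hL) x y →
      MatrixUnitLE (arrowHom hZ hL) y x := fun x y h =>
    MatrixUnitLE.symm_of_radical_eq_bot hrad hker (fun D hD a b hab => by
      obtain ⟨φ, hφ, -⟩ := exists_arrowMatrix_eq_of_mem_innerDer hZ hD
      exact hφ a b hab.symm) hE hext h
  have hpar : ∀ x y : Quiver.Total V, MatrixUnitLE (arrowHom hZ hL) x y →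
      x.left = y.left ∧ x.right = y.right := by
    rintro x y ⟨D, hD⟩
    refine arrowMatrix_apply_ne_zero D.2 ?_
    change arrowHom hZ hL D y x ≠ 0
    rw [hD, Matrix.single_apply_same]
    exact one_ne_zero
  have hpot : ∀ x : Quiver.Total V, ∃ φ : V → k, ∀ y : Quiver.Total V,
      φ y.right - φ y.left = if MatrixUnitLE (arrowHom hZ hL) x y then 1 else 0 := by
    intro x
    obtain ⟨D, hD, hDx⟩ := exists_mem_map_eq_diagonal hrad hker hE hext hsymm x
    obtain ⟨φ, -, hφ⟩ := exists_arrowMatrix_eq_of_mem_innerDer hZ hD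
    refine ⟨φ, fun y => ?_⟩
    rw [← hφ]
    change arrowHom hZ hL D y y = _
    rw [hDx, Matrix.diagonal_apply_eq]
  refine ⟨fun x => ?_, isCompletelySaturated_of_matrixUnitLE hZ hL fun x y h1 h2 => ?_⟩
  · obtain ⟨φ, hφ⟩ := hpot x
    exact ⟨φ, by rw [hφ, if_pos (hE x)], fun y hy => by rw [hφ, if_neg (hy ∘ hpar x y)]⟩
  · obtain ⟨φ, hφ⟩ := hpot x
    -- A coboundary takes the same value on parallel arrows, but the indicator would be `1` on `x`
    -- and `0` on `y`.
    by_contra h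
    have hx := hφ x
    have hy := hφ y
    rw [if_pos (hE x), h1, h2] at hx
    rw [if_neg h, hx] at hy
    exact one_ne_zero hy

end Radical

end Inner
end MonomialAlgebra

/-! ### Trees and potentials -/

section Trees

variable {V : Type u} [Quiver.{v} V]

theorem exists_mem_representativeSubquiver {a b : V} (e : a ⟶ b) :
    ∃ e' : a ⟶ b, e' ∈ representativeSubquiver V a b := by
  have h := Quotient.mk_out (s := parallelSetoid V) ⟨a, b, e⟩
  have h' : Quotient.mk (parallelSetoid V)
      (Quotient.out (Quotient.mk (parallelSetoid V) ⟨a, b, e⟩))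
        = Quotient.mk (parallelSetoid V) ⟨a, b, e⟩ := Quotient.out_eq _
  generalize hx : Quotient.out (Quotient.mk (parallelSetoid V) ⟨a, b, e⟩) = x at h h'
  obtain ⟨a', b', e'⟩ := x
  obtain ⟨rfl, rfl⟩ : a' = a ∧ b' = b := h
  exact ⟨e', (congrArg Quotient.out h').trans hx⟩

theorem representativeSubquiver_subsingleton {a b : V} {e e' : a ⟶ b}
    (he : e ∈ representativeSubquiver V a b) (he' : e' ∈ representativeSubquiver V a b) :
    e = e' := by
  have h : Quotient.mk (parallelSetoid V) ⟨a, b, e⟩ = Quotient.mk (parallelSetoid V) ⟨a, b, e'⟩ :=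
    Quotient.sound ⟨rfl, rfl⟩
  have h1 : (⟨a, b, e⟩ : Quiver.Total V) = ⟨a, b, e'⟩ :=
    he.symm.trans ((congrArg Quotient.out h).trans he')
  cases h1
  rfl

theorem underlyingGraph_representativeSubquiver :
    underlyingGraph (WideSubquiver.toType V (representativeSubquiver V)) = underlyingGraph V := by
  have h : ∀ a b : V, Nonempty ((show WideSubquiver.toType V (representativeSubquiver V) from a)
      ⟶ (show WideSubquiver.toType V (representativeSubquiver V) from b)) ↔ Nonempty (a ⟶ b) :=
    fun a b => ⟨fun ⟨e⟩ => ⟨e.1⟩, fun ⟨e⟩ =>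
      (exists_mem_representativeSubquiver e).elim fun e' he' => ⟨⟨e', he'⟩⟩⟩
  ext a b
  exact and_congr Iff.rfl (or_congr (h a b) (h b a))

/-- A potential that jumps only across one parallel class excludes a loop or a reverse arrow there.
It is constant along walks avoiding the corresponding edge, so that edge is a bridge; a connected
graph all of whose edges are bridges is a tree. -/
theorem quiverIsTree_of_potential {A : Type*} [AddCommGroup A] {c : A} (hc : c ≠ 0)
    (hQ : QuiverConnected V)
    (h : ∀ x : Quiver.Total V, ∃ φ : V → A, φ x.right - φ x.left = c ∧
      ∀ y : Quiver.Total V, ¬ (x.left = y.left ∧ x.right = y.right) →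
        φ y.right - φ y.left = 0) :
    QuiverIsTree (WideSubquiver.toType V (representativeSubquiver V)) := by
  have hloop : ∀ a : V, IsEmpty (a ⟶ a) := fun a => ⟨fun e => by
    obtain ⟨φ, hφ, -⟩ := h ⟨a, a, e⟩
    exact hc (hφ.symm.trans (sub_self _))⟩
  have htwo : ∀ {a b : V}, (a ⟶ b) → (b ⟶ a) → False := fun {a b} e e' => by
    obtain ⟨φ, hφ, hφ'⟩ := h ⟨a, b, e⟩
    refine hc (hφ.symm.trans ?_)
    rw [← neg_sub, hφ' ⟨b, a, e'⟩, neg_zero]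
    intro h'
    obtain rfl : a = b := h'.1
    exact (hloop _).false e
  refine ⟨fun a => ⟨fun e => (hloop a).false e.1⟩, fun a b => ⟨?_⟩, ?_⟩
  · rintro (e | e) (e' | e')
    · exact congrArg Sum.inl (Subtype.ext (representativeSubquiver_subsingleton e.2 e'.2))
    · exact (htwo e.1 e'.1).elim
    · exact (htwo e.1 e'.1).elim
    · exact congrArg Sum.inr (Subtype.ext (representativeSubquiver_subsingleton e.2 e'.2))
  · rw [underlyingGraph_representativeSubquiver]
    refine ⟨hQ, SimpleGraph.isAcyclic_iff_forall_adj_isBridge.2 ?_⟩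
    have key : ∀ {v w : V}, (v ⟶ w) → (underlyingGraph V).IsBridge s(v, w) := by
      intro v w e
      obtain ⟨φ, hφ, hφ'⟩ := h ⟨v, w, e⟩
      have hconst : ∀ {a b : V}, (a ⟶ b) → s(a, b) ≠ s(v, w) → φ a = φ b := by
        intro a b e' hne
        refine (sub_eq_zero.1 (hφ' ⟨a, b, e'⟩ ?_)).symm
        rintro ⟨rfl, rfl⟩
        exact hne rfl
      rw [SimpleGraph.isBridge_iff]
      have hwalk : ∀ {a b : V}, ((underlyingGraph V).deleteEdges {s(v, w)}).Walk a b →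
          φ a = φ b := by
        intro a b p
        induction p with
        | nil => rfl
        | @cons a b _ hab _ ih =>
          rw [← ih]
          rw [SimpleGraph.deleteEdges_adj, Set.mem_singleton_iff] at hab
          rcases ((SimpleGraph.fromRel_adj _ _ _).1 hab.1).2 with ⟨⟨e⟩⟩ | ⟨⟨e⟩⟩
          · exact hconst e hab.2
          · exact (hconst e fun h' => hab.2 (Sym2.eq_swap.trans h')).symm
      rintro ⟨p⟩
      exact hc (hφ.symm.trans (sub_eq_zero.2 (hwalk p).symm))
    intro v w hvw
    rcases ((SimpleGraph.fromRel_adj _ _ _).1 hvw).2 with ⟨⟨e⟩⟩ | ⟨⟨e⟩⟩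
    · exact key e
    · rw [Sym2.eq_swap]
      exact key e

/-- Deleting the edge of `x` disconnects its endpoints. The potential is the indicator of the
component of the target of `x`, and every arrow not parallel to `x` stays within a component. -/
theorem exists_indicator_potential
    (h : QuiverIsTree (WideSubquiver.toType V (representativeSubquiver V))) (x : Quiver.Total V) :
    ∃ φ : V → ℤ, φ x.right - φ x.left = 1 ∧
      ∀ y : Quiver.Total V, ¬ (x.left = y.left ∧ x.right = y.right) →
        φ y.right - φ y.left = 0 := by
  classical
  have hloop : ∀ a : V, IsEmpty (a ⟶ a) := fun a => ⟨fun e =>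
    (exists_mem_representativeSubquiver e).elim fun e' he' => (h.no_loop a).false ⟨e', he'⟩⟩
  have htwo : ∀ {a b : V}, (a ⟶ b) → (b ⟶ a) → False := fun {a b} e e' => by
    obtain ⟨f, hf⟩ := exists_mem_representativeSubquiver e
    obtain ⟨f', hf'⟩ := exists_mem_representativeSubquiver e'
    have := (h.no_two_cycle a b).elim (Sum.inl ⟨f, hf⟩) (Sum.inr ⟨f', hf'⟩)
    cases this
  have hadj : ∀ y : Quiver.Total V, (underlyingGraph V).Adj y.left y.right := fun y =>
    (SimpleGraph.fromRel_adj _ _ _).2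
      ⟨fun h' => (hloop y.left).false (cast (by rw [h']) y.hom), Or.inl ⟨y.hom⟩⟩
  have hacyc := h.isTree.2
  rw [underlyingGraph_representativeSubquiver] at hacyc
  have hbridge : ¬ ((underlyingGraph V).deleteEdges {s(x.left, x.right)}).Reachable x.left
      x.right := SimpleGraph.isBridge_iff.1
    (SimpleGraph.isAcyclic_iff_forall_adj_isBridge.1 hacyc (hadj x))
  refine ⟨fun v => if ((underlyingGraph V).deleteEdges {s(x.left, x.right)}).Reachable v x.right
    then 1 else 0, ?_, fun y hy => ?_⟩
  · beta_reduce
    rw [if_pos (SimpleGraph.Reachable.refl _), if_neg hbridge, sub_zero]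
  · have hy' : ((underlyingGraph V).deleteEdges {s(x.left, x.right)}).Adj y.left y.right := by
      rw [SimpleGraph.deleteEdges_adj]
      refine ⟨hadj y, fun hmem => ?_⟩
      rcases Sym2.eq_iff.1 (Set.mem_singleton_iff.1 hmem) with ⟨h1, h2⟩ | ⟨h1, h2⟩
      · exact hy ⟨h1.symm, h2.symm⟩
      · exact htwo x.hom (cast (by rw [h1, h2]) y.hom)
    have : ((underlyingGraph V).deleteEdges {s(x.left, x.right)}).Reachable y.right x.right ↔
        ((underlyingGraph V).deleteEdges {s(x.left, x.right)}).Reachable y.left x.right :=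
      ⟨fun h => hy'.reachable.trans h, fun h => hy'.symm.reachable.trans h⟩
    simp only [this, sub_self]

theorem exists_potential [Finite (Quiver.Total V)]
    (h : QuiverIsTree (WideSubquiver.toType V (representativeSubquiver V))) {A : Type*}
    [AddCommGroup A] (c : ParallelClass V → A) :
    ∃ φ : V → A, ∀ x : Quiver.Total V,
      φ x.right - φ x.left = c (Quotient.mk (parallelSetoid V) x) := by
  classical
  have := Fintype.ofFinite (ParallelClass V)
  choose φ hφ hφ' using exists_indicator_potential h
  refine ⟨fun v => ∑ q : ParallelClass V, φ q.out v • c q, fun x => ?_⟩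
  rw [← Finset.sum_sub_distrib, Finset.sum_eq_single (Quotient.mk (parallelSetoid V) x)]
  · obtain ⟨h1, h2⟩ := Quotient.mk_out (s := parallelSetoid V) x
    have := hφ (Quotient.mk (parallelSetoid V) x).out
    rw [← sub_smul, ← h1, ← h2, this, one_smul]
  · intro q _ hq
    rw [← sub_smul, hφ' q.out x, zero_smul]
    intro h'
    refine hq ?_
    rw [← Quotient.out_eq q]
    exact Quotient.sound h'
  · exact fun h => absurd (Finset.mem_univ _) h

/-- In a quiver whose arrows form a tree, up to parallelism, the paths which are parallel to an arrow
are arrows. -/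
theorem length_eq_one_of_parallel [Finite (Quiver.Total V)]
    (h : QuiverIsTree (WideSubquiver.toType V (representativeSubquiver V))) {a b : V} (e : a ⟶ b)
    (p : Path a b) : p.length = 1 := by
  -- This potential rises by one along every arrow, so its difference between the endpoints of a
  -- path is the length.
  obtain ⟨φ, hφ⟩ := exists_potential h (fun _ => (1 : ℤ))
  have hp : ∀ {b : V} (p : Path a b), φ b - φ a = p.length := by
    intro b p
    induction p with
    | nil => simp
    | @cons b c p e ih =>
      have := hφ ⟨b, c, e⟩
      rw [Path.length_cons]
      push_cast
      linarith
  have h1 := hp p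
  rw [hφ ⟨a, b, e⟩] at h1
  exact_mod_cast h1.symm

end Trees

namespace MonomialAlgebra

/-! ### The first cohomology when the quiver is a tree up to parallelism. -/

section TreeCohomology

attribute [local instance] LieRing.ofAssociativeRing LieAlgebra.ofAssociativeAlgebra

theorem _root_.LieHom.nonempty_lieEquiv_of_surjective {k L L' : Type*} [Field k] [LieRing L]
    [LieAlgebra k L] [LieRing L'] [LieAlgebra k L'] (Φ : L →ₗ⁅k⁆ L') (hΦ : Function.Surjective Φ)
    (K : LieIdeal k L) (hK : ∀ D, D ∈ K ↔ Φ D = 0) : Nonempty ((L ⧸ K) ≃ₗ⁅k⁆ L') := by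
  obtain rfl : K = Φ.ker := by
    ext D
    rw [hK, LieHom.mem_ker]
  have hr : Φ.range = ⊤ := (LieHom.range_eq_top Φ).2 hΦ
  exact ⟨Φ.quotKerEquivRange.trans ((LieEquiv.ofEq Φ.range ⊤ (by rw [hr])).trans
    LieSubalgebra.topEquiv)⟩

variable {k : Type w} [Field k] {V : Type u} [Quiver.{v} V] [Fintype V]
  {Z : PathSet V}

theorem coef_ext {x : MonomialAlgebra k Z} (h : ∀ {a b : V} (p : Path a b), coef p x = 0) :
    x = 0 := by
  obtain ⟨s, hs⟩ := exists_eq_sum x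
  rw [hs]
  exact Finset.sum_eq_zero fun η _ => by rw [h, zero_smul]

/-- A linear endomorphism which satisfies the Leibniz rule is zero if it vanishes on the vertices
and on the arrows. -/
theorem der_eq_zero_of_forall {f : Module.End k (MonomialAlgebra k Z)}
    (hf : f ∈ hochschildDer k (MonomialAlgebra k Z))
    (h0 : ∀ i : V, f (ofPath k Z (Path.nil : Path i i)) = 0)
    (h1 : ∀ x : Quiver.Total V, f (ofPath k Z x.hom.toPath) = 0) : f = 0 := by
  refine linearMap_ext fun {a b} p => ?_
  rw [LinearMap.zero_apply]
  induction p with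
  | nil => exact h0 a
  | @cons b c p e ih =>
    rw [ofPath_cons, map_mul_of_mem_der hf, ih, h1 ⟨b, c, e⟩, mul_zero, zero_mul, add_zero]

/-- The derivation `x ↦ ax - xa`. -/
def adEnd (a : MonomialAlgebra k Z) : Module.End k (MonomialAlgebra k Z) :=
  LinearMap.mulLeft k a - LinearMap.mulRight k a

theorem adEnd_apply (a x : MonomialAlgebra k Z) : adEnd a x = a * x - x * a := rfl

theorem adEnd_mem (a : MonomialAlgebra k Z) : adEnd a ∈ hochschildDer k (MonomialAlgebra k Z) := by
  intro x y
  rw [adEnd_apply, adEnd_apply, adEnd_apply, mul_sub, sub_mul, mul_assoc, mul_assoc, mul_assoc]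
  abel

theorem exists_adEnd_of_function (θ : V → k) :
    ∃ a : MonomialAlgebra k Z, (∀ i : V, adEnd a (ofPath k Z (Path.nil : Path i i)) = 0) ∧
      ∀ x : Quiver.Total V, adEnd a (ofPath k Z x.hom.toPath)
        = (θ x.right - θ x.left) • ofPath k Z x.hom.toPath := by
  have hl : ∀ {i j : V} (p : Path i j), (∑ v : V, θ v • ofPath k Z (Path.nil : Path v v))
      * ofPath k Z p = θ j • ofPath k Z p := by
    intro i j p
    rw [Finset.sum_mul, Finset.sum_eq_single j]
    · rw [smul_mul_assoc, ofPath_nil_mul]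
    · intro v _ hv
      rw [smul_mul_assoc, ofPath_mul_ofPath_of_ne _ _ hv.symm, smul_zero]
    · exact fun h => absurd (Finset.mem_univ _) h
  have hr : ∀ {i j : V} (p : Path i j), ofPath k Z p *
      (∑ v : V, θ v • ofPath k Z (Path.nil : Path v v)) = θ i • ofPath k Z p := by
    intro i j p
    rw [Finset.mul_sum, Finset.sum_eq_single i]
    · rw [mul_smul_comm, ofPath_mul_nil]
    · intro v _ hv
      rw [mul_smul_comm, ofPath_mul_ofPath_of_ne _ _ hv, smul_zero]
    · exact fun h => absurd (Finset.mem_univ _) h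
  refine ⟨∑ v : V, θ v • ofPath k Z (Path.nil : Path v v), fun i => ?_, fun x => ?_⟩
  · rw [adEnd_apply, hl, hr, sub_self]
  · rw [adEnd_apply, hl, hr, sub_smul]

variable [∀ a b : V, Finite (a ⟶ b)]

/-- If the quiver is a tree up to parallelism, then a derivation which vanishes on the vertices is
determined by its matrix. -/
theorem der_arrow_eq_sum_of_isTree (hZ : IsMinimalRelations Z)
    (ht : QuiverIsTree (WideSubquiver.toType V (representativeSubquiver V)))
    {f : Module.End k (MonomialAlgebra k Z)} (hf : f ∈ hochschildDer k (MonomialAlgebra k Z))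
    (h0 : ∀ i : V, f (ofPath k Z (Path.nil : Path i i)) = 0) (x : Quiver.Total V) :
    f (ofPath k Z x.hom.toPath)
      = ∑ y : Quiver.Total V, arrowMatrix f y x • ofPath k Z y.hom.toPath := by
  rw [← sub_eq_zero]
  -- As `f` kills the vertices, `f x` is a combination of paths parallel to `x`, and on a tree these
  -- are arrows.
  have h1 : ofPath k Z (Path.nil : Path x.right x.right) * f (ofPath k Z x.hom.toPath)
      * ofPath k Z (Path.nil : Path x.left x.left) = f (ofPath k Z x.hom.toPath) := by
    have hl := map_mul_of_mem_der hf (ofPath k Z (Path.nil : Path x.right x.right))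
      (ofPath k Z x.hom.toPath)
    have hr := map_mul_of_mem_der hf (ofPath k Z x.hom.toPath)
      (ofPath k Z (Path.nil : Path x.left x.left))
    rw [ofPath_nil_mul, h0, zero_mul, add_zero] at hl
    rw [ofPath_mul_nil, h0, mul_zero, zero_add] at hr
    rw [← hl, ← hr]
  refine coef_ext fun {a b} p => ?_
  by_cases hp : p.length = 1
  · obtain ⟨c, e, q, hq, rfl⟩ := Path.eq_toPath_comp_of_length_eq_succ p (n := 0) (by omega)
    obtain rfl := Path.eq_of_length_zero q hq
    rw [Path.eq_nil_of_length_zero q hq, Path.comp_nil, map_sub, map_sum,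
      Finset.sum_eq_single (⟨a, c, e⟩ : Quiver.Total V)]
    · rw [map_smul, coef_ofPath_self (mem_nonzeroPaths_of_length hZ (by simp)), smul_eq_mul,
        mul_one, arrowMatrix, sub_self]
    · intro y _ hy
      rw [map_smul, coef_ofPath_of_ne, smul_zero]
      exact fun h => hy (total_eq_of_sigma_eq (x := ⟨a, c, e⟩) h).symm
    · exact fun h => absurd (Finset.mem_univ _) h
  · rw [map_sub, map_sum, Finset.sum_eq_zero, sub_zero]
    · by_cases hpar : a = x.left ∧ b = x.right
      · obtain ⟨rfl, rfl⟩ := hpar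
        exact absurd (length_eq_one_of_parallel ht x.hom p) hp
      · rw [← h1]
        by_cases ha : a = x.left
        · rw [mul_assoc]
          exact coef_mul_eq_zero_of_forall (fun γ h' => hpar
            ⟨ha, congrArg (fun η : QuiverPath V => η.2.1) h'⟩) _
        · exact coef_mul_eq_zero_of_forall' (fun γ h' => ha (congrArg Sigma.fst h')) _
    · intro y _
      rw [map_smul, coef_ofPath_of_ne, smul_zero]
      intro h
      exact hp (congrArg (fun η : QuiverPath V => η.2.2.length) h)

/-- If the quiver is a tree up to parallelism, then a derivation whose matrix is scalar on every
class of parallel arrows is inner. -/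
theorem mem_innerDer_of_isTree (hZ : IsMinimalRelations Z)
    (ht : QuiverIsTree (WideSubquiver.toType V (representativeSubquiver V)))
    (D : hochschildDer k (MonomialAlgebra k Z)) (c : ParallelClass V → k)
    (hc : ∀ x : Quiver.Total V, arrowMatrix (D : Module.End k (MonomialAlgebra k Z)) x x
      = c (Quotient.mk (parallelSetoid V) x))
    (hne : ∀ x y : Quiver.Total V, y ≠ x →
      arrowMatrix (D : Module.End k (MonomialAlgebra k Z)) y x = 0) :
    D ∈ innerDer k (MonomialAlgebra k Z) := by
  obtain ⟨a, ha⟩ := exists_inner_sub_vertex D.2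
  obtain ⟨ψ, hψ, hψ'⟩ := exists_arrowMatrix_eq_of_mem_innerDer (Z := Z) hZ
    (D := ⟨adEnd a, adEnd_mem a⟩) (mem_innerDer_iff.2 ⟨a, fun x => adEnd_apply a x⟩)
  obtain ⟨φ, hφ⟩ := exists_potential ht c
  -- Subtracting `ad a` makes `D` vanish on the vertices, at the cost of the coboundary of `ψ` on
  -- the arrows. What remains acts on the arrows by the coboundary of `φ - ψ`, that is, as `ad b`.
  obtain ⟨b, hb0, hb1⟩ := exists_adEnd_of_function (Z := Z) (φ - ψ)
  have hD' := Submodule.sub_mem (hochschildDer k (MonomialAlgebra k Z)).toSubmodule D.2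
    (adEnd_mem a)
  have hM : ∀ y x : Quiver.Total V, arrowMatrix ((D : Module.End k (MonomialAlgebra k Z)) - adEnd a)
      y x = arrowMatrix (D : Module.End k (MonomialAlgebra k Z)) y x - arrowMatrix (adEnd a) y x :=
    fun y x => map_sub (coef y.hom.toPath) _ _
  have h0 : ∀ i : V, ((D : Module.End k (MonomialAlgebra k Z)) - adEnd a)
      (ofPath k Z (Path.nil : Path i i)) = 0 := fun i => by
    rw [LinearMap.sub_apply, ha, adEnd_apply, sub_self]
  have hzero : (D : Module.End k (MonomialAlgebra k Z)) - adEnd a - adEnd b = 0 := by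
    refine der_eq_zero_of_forall (Submodule.sub_mem
      (hochschildDer k (MonomialAlgebra k Z)).toSubmodule hD' (adEnd_mem b)) (fun i => ?_)
      fun x => ?_
    · rw [LinearMap.sub_apply, h0, hb0, sub_zero]
    · rw [LinearMap.sub_apply, der_arrow_eq_sum_of_isTree hZ ht hD' h0, hb1,
        Finset.sum_eq_single x, ← sub_smul, hM, hc, hψ', ← hφ]
      · simp only [Pi.sub_apply]
        rw [show φ x.right - φ x.left - (ψ x.right - ψ x.left)
          - (φ x.right - ψ x.right - (φ x.left - ψ x.left)) = 0 by ring, zero_smul]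
      · intro y _ hy
        rw [hM, hne _ _ hy, hψ _ _ hy, sub_zero, zero_smul]
      · exact fun h => absurd (Finset.mem_univ _) h
  refine mem_innerDer_iff.2 ⟨a + b, fun x => ?_⟩
  have := LinearMap.congr_fun hzero x
  rw [LinearMap.sub_apply, LinearMap.sub_apply, adEnd_apply, adEnd_apply, LinearMap.zero_apply,
    sub_sub, sub_eq_zero] at this
  rw [this, add_mul, mul_add]
  abel

omit [Fintype V] in
/-- The enumeration of a class of parallel arrows. -/
def _root_.ParallelClass.enum (c : ParallelClass V) :
    Fin c.card ≃ {x : Quiver.Total V // Quotient.mk (parallelSetoid V) x = c} :=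
  (Finite.equivFin _).symm

/-- The matrix of a derivation on a class of parallel arrows. -/
def classMatrix (f : Module.End k (MonomialAlgebra k Z)) (c : ParallelClass V) :
    Matrix (Fin c.card) (Fin c.card) k := fun i j => arrowMatrix f (c.enum i).1 (c.enum j).1

/-- Matrices of derivations are block diagonal along the parallel classes, so the sum over all
arrows reduces to one class. -/
theorem classMatrix_mul (hZ : IsMinimalRelations Z) (hL : LMinusOne k Z = ⊥)
    {f g : Module.End k (MonomialAlgebra k Z)}
    (hf : f ∈ hochschildDer k (MonomialAlgebra k Z))
    (hg : g ∈ hochschildDer k (MonomialAlgebra k Z)) (c : ParallelClass V) :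
    classMatrix (f * g) c = classMatrix f c * classMatrix g c := by
  classical
  ext i j
  rw [classMatrix, arrowMatrix_mul hZ hL hf hg, Matrix.mul_apply, Matrix.mul_apply]
  symm
  refine Finset.sum_of_injOn (fun m => (c.enum m).1) ?_ (fun _ _ => Finset.mem_coe.2
    (Finset.mem_univ _)) ?_ fun _ _ => rfl
  · exact (Subtype.val_injective.comp c.enum.injective).injOn
  · intro z _ hz
    by_contra h
    refine hz ⟨c.enum.symm ⟨z, ?_⟩, Finset.mem_coe.2 (Finset.mem_univ _), by simp⟩
    rw [← (c.enum j).2]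
    have := arrowMatrix_apply_ne_zero hg (right_ne_zero_of_mul h)
    exact (Quotient.sound this).symm

/-- The homomorphism from the derivations to the product of the Lie algebras `pgl`. -/
def classHom (hZ : IsMinimalRelations Z) (hL : LMinusOne k Z = ⊥) :
    hochschildDer k (MonomialAlgebra k Z) →ₗ⁅k⁆ ∀ c : ParallelClass V, PGL k c.card where
  toFun D := fun c => LieSubmodule.Quotient.mk' (scalarIdeal k c.card)
    (classMatrix (D : Module.End k (MonomialAlgebra k Z)) c)
  map_add' D D' := funext fun c => by
    rw [Pi.add_apply, ← map_add]
    congr 1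
    ext i j
    exact map_add (coef (k := k) (Z := Z) (c.enum i).1.hom.toPath) _ _
  map_smul' r D := funext fun c => by
    rw [Pi.smul_apply, RingHom.id_apply, ← map_smul]
    congr 1
    ext i j
    exact map_smul (coef (k := k) (Z := Z) (c.enum i).1.hom.toPath) r _
  map_lie' {D D'} := funext fun c => by
    rw [pi_lie_apply]
    refine Eq.trans ?_ (LieSubmodule.Quotient.mk_bracket (scalarIdeal k c.card)
      (classMatrix (D : Module.End k (MonomialAlgebra k Z)) c)
      (classMatrix (D' : Module.End k (MonomialAlgebra k Z)) c))
    refine congrArg (LieSubmodule.Quotient.mk' (scalarIdeal k c.card)) ?_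
    rw [LieRing.of_associative_ring_bracket, ← classMatrix_mul hZ hL D.2 D'.2,
      ← classMatrix_mul hZ hL D'.2 D.2]
    ext i j
    exact map_sub (coef (k := k) (Z := Z) (c.enum i).1.hom.toPath) _ _

/-- Inner derivations act by differences of a function on the vertices, which is scalar on each
class. Conversely, on a tree any choice of scalars is such a coboundary. -/
theorem classHom_eq_zero_iff (hZ : IsMinimalRelations Z) (hL : LMinusOne k Z = ⊥)
    (ht : QuiverIsTree (WideSubquiver.toType V (representativeSubquiver V)))
    (D : hochschildDer k (MonomialAlgebra k Z)) :
    D ∈ innerDer k (MonomialAlgebra k Z) ↔ classHom hZ hL D = 0 := by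
  have hmem : classHom hZ hL D = 0 ↔ ∀ c : ParallelClass V,
      classMatrix (D : Module.End k (MonomialAlgebra k Z)) c ∈ scalarIdeal k c.card := by
    rw [funext_iff]
    exact forall_congr' fun c => LieSubmodule.Quotient.mk_eq_zero _
  rw [hmem]
  constructor
  · intro hD c
    obtain ⟨φ, hφ, hφ'⟩ := exists_arrowMatrix_eq_of_mem_innerDer hZ hD
    refine mem_scalarIdeal_of_forall fun i j hij => ⟨?_, ?_⟩
    · exact hφ _ _ fun h => hij (c.enum.injective (Subtype.ext h))
    · rw [classMatrix, classMatrix, hφ', hφ']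
      obtain ⟨h1, h2⟩ := Quotient.exact ((c.enum i).2.trans (c.enum j).2.symm)
      rw [h1, h2]
  · intro h
    choose r hr using fun c => mem_scalarIdeal.1 (h c)
    have hent : ∀ (c : ParallelClass V) (i j : Fin c.card),
        arrowMatrix (D : Module.End k (MonomialAlgebra k Z)) (c.enum i).1 (c.enum j).1
          = if i = j then r c else 0 := fun c i j => by
      have := congrFun (congrFun (hr c) i) j
      rw [Matrix.smul_apply, Matrix.one_apply, smul_eq_mul, mul_ite, mul_one, mul_zero] at this
      exact this.symm
    refine mem_innerDer_of_isTree hZ ht D r (fun x => ?_) fun x y hxy => ?_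
    · have := hent (Quotient.mk (parallelSetoid V) x)
        ((ParallelClass.enum _).symm ⟨x, rfl⟩) ((ParallelClass.enum _).symm ⟨x, rfl⟩)
      rwa [if_pos rfl, Equiv.apply_symm_apply] at this
    · by_contra hne
      have hq : Quotient.mk (parallelSetoid V) y = Quotient.mk (parallelSetoid V) x :=
        (Quotient.sound (arrowMatrix_apply_ne_zero D.2 hne)).symm
      have := hent (Quotient.mk (parallelSetoid V) x)
        ((ParallelClass.enum _).symm ⟨y, hq⟩) ((ParallelClass.enum _).symm ⟨x, rfl⟩)
      rw [if_neg, Equiv.apply_symm_apply, Equiv.apply_symm_apply] at this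
      · exact hne this
      · intro h'
        exact hxy (congrArg Subtype.val ((ParallelClass.enum _).symm.injective h'))

theorem classHom_surjective (hZ : IsMinimalRelations Z) (hL : LMinusOne k Z = ⊥)
    (hs : IsCompletelySaturated k Z) : Function.Surjective (classHom (k := k) hZ hL) := by
  classical
  intro t
  choose N hN using fun c => LieSubmodule.Quotient.surjective_mk' (scalarIdeal k c.card) (t c)
  obtain ⟨f, hf, -, hf1⟩ := exists_der_of_matrix (Z := Z) (fun y x : Quiver.Total V =>
      if h : Quotient.mk (parallelSetoid V) y = Quotient.mk (parallelSetoid V) x then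
        N (Quotient.mk (parallelSetoid V) x) ((ParallelClass.enum _).symm ⟨y, h⟩)
          ((ParallelClass.enum _).symm ⟨x, rfl⟩) else 0)
    (fun y x h => by
      by_cases hq : Quotient.mk (parallelSetoid V) y = Quotient.mk (parallelSetoid V) x
      · exact Quotient.exact hq.symm
      · exact absurd (dif_neg hq) h)
    (fun l e e' r hp _ => IsCompletelySaturated.notMem_nonzeroPaths hs l e e' r hp)
  refine ⟨⟨f, hf⟩, funext fun c => (congrArg _ ?_).trans (hN c)⟩
  ext i j
  rw [classMatrix, arrowMatrix_eq_of_forall hZ hf1]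
  -- The size of the matrix `N c` depends on `c`; with `x` and `y` generalized, the equality of
  -- classes can be substituted.
  have key : ∀ x (hx : Quotient.mk (parallelSetoid V) x = c) y
      (hy : Quotient.mk (parallelSetoid V) y = c),
      (if h : Quotient.mk (parallelSetoid V) y = Quotient.mk (parallelSetoid V) x then
        N (Quotient.mk (parallelSetoid V) x) ((ParallelClass.enum _).symm ⟨y, h⟩)
          ((ParallelClass.enum _).symm ⟨x, rfl⟩) else 0)
        = N c (c.enum.symm ⟨y, hy⟩) (c.enum.symm ⟨x, hx⟩) := by
    rintro x rfl y hy
    rw [dif_pos hy]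
  refine (key _ (c.enum j).2 _ (c.enum i).2).trans ?_
  rw [Subtype.coe_eta, Subtype.coe_eta, Equiv.symm_apply_apply, Equiv.symm_apply_apply]

/-- If the quiver is a tree up to parallelism and if the ideal is completely saturated, then the
first Hochschild cohomology is the product of the Lie algebras `pgl` of the classes of parallel
arrows. -/
theorem nonempty_lieEquiv_of_isTree (hZ : IsMinimalRelations Z) (hL : LMinusOne k Z = ⊥)
    (ht : QuiverIsTree (WideSubquiver.toType V (representativeSubquiver V)))
    (hs : IsCompletelySaturated k Z) :
    Nonempty (HH1 k (MonomialAlgebra k Z) ≃ₗ⁅k⁆ ∀ c : ParallelClass V, PGL k c.card) :=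
  LieHom.nonempty_lieEquiv_of_surjective (classHom hZ hL) (classHom_surjective hZ hL hs) _
    (classHom_eq_zero_iff hZ hL ht)

end TreeCohomology

end MonomialAlgebra

/-! ### Nontriviality, characteristic two and the equivalence. -/

theorem nontrivial_pi_PGL_iff {k : Type w} [Field k] {V : Type u} [Quiver.{v} V] :
    Nontrivial (∀ c : ParallelClass V, PGL k c.card) ↔ ∃ c : ParallelClass V, 2 ≤ c.card := by
  constructor
  · intro h
    obtain ⟨x, hx⟩ := exists_ne (0 : ∀ c : ParallelClass V, PGL k c.card)
    obtain ⟨c, hc⟩ := Function.ne_iff.1 hx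
    exact ⟨c, PGL.nontrivial_iff.1 ⟨⟨_, _, hc⟩⟩⟩
  · rintro ⟨c, hc⟩
    have : Nontrivial (PGL k c.card) := PGL.nontrivial_iff.2 hc
    exact Pi.nontrivial_at c

theorem charP_two_iff {k : Type w} [Field k] : CharP k 2 ↔ (2 : k) = 0 := by
  refine ⟨fun h => CharTwo.two_eq_zero, fun h => CharTwo.of_one_ne_zero_of_two_eq_zero one_ne_zero h⟩

end

theorem mainTheorem3 {k : Type w} [Field k] [IsAlgClosed k]
    {V : Type u} [Quiver.{v} V] [Fintype V] [∀ a b : V, Finite (a ⟶ b)]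
    (hQ : QuiverConnected V)
    (Z : PathSet V) (hZ : IsMinimalRelations Z)
    (hfin : FiniteDimensional k (MonomialAlgebra k Z))
    (hL : LMinusOne k Z = ⊥) :
    List.TFAE [
      IsSemisimpleLie k (HH1 k (MonomialAlgebra k Z)),
      QuiverIsTree (WideSubquiver.toType V (representativeSubquiver V)) ∧
        (∃ c : ParallelClass V, 2 ≤ c.card) ∧
        IsCompletelySaturated k Z ∧
        (CharP k 2 → ∀ c : ParallelClass V, c.card ≠ 2),
      Nontrivial (∀ c : ParallelClass V, PGL k c.card) ∧
        Nonempty (HH1 k (MonomialAlgebra k Z) ≃ₗ⁅k⁆ ∀ c : ParallelClass V, PGL k c.card) ∧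
        (CharP k 2 → ∀ c : ParallelClass V, c.card ≠ 2)] := by
  tfae_have 1 → 2 := by
    rintro ⟨hnon, hrad⟩
    obtain ⟨hpot, hs⟩ :=
      MonomialAlgebra.exists_potential_and_isCompletelySaturated hZ hL hrad
    have ht := quiverIsTree_of_potential (one_ne_zero (α := k)) hQ hpot
    obtain ⟨e⟩ := MonomialAlgebra.nonempty_lieEquiv_of_isTree hZ hL ht hs
    refine ⟨ht, nontrivial_pi_PGL_iff.1 e.injective.nontrivial, hs,
      fun hchar c hc => ?_⟩
    -- Zero radical passes through the isomorphism to the product and then to each factor, which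
    -- excludes `pgl(2)` in characteristic two.
    exact PGL.radical_ne_bot_of_two hc (charP_two_iff.1 hchar)
      (radical_eq_bot_of_pi (e.symm.radical_eq_bot hrad) c)
  tfae_have 2 → 3 := fun ⟨ht, hc, hs, hchar⟩ =>
    ⟨nontrivial_pi_PGL_iff.2 hc, MonomialAlgebra.nonempty_lieEquiv_of_isTree hZ hL ht hs, hchar⟩
  tfae_have 3 → 1 := by
    rintro ⟨hnon, ⟨e⟩, hchar⟩
    refine ⟨e.symm.injective.nontrivial, e.radical_eq_bot (pi_radical_eq_bot fun c => ?_)⟩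
    exact PGL.radical_eq_bot fun hc h2 => hchar (charP_two_iff.2 h2) c hc
  tfae_finish
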